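/- For $n\ge 1$ and $\omega>0$ let $\nu_{n,\omega}$ be the uniform probability measure on the sphere $S^{n-1}(\omega)=\{\eta\in\mathbb{R}^n:\sum_i\eta_i^2=\omega\}$. For indices $i\ne j$ let $R^{ij}_\theta$ be the clockwise rotation by the angle $\theta$ in the plane $(\eta_i,\eta_j)$, put $R^{ii}_\theta=\mathrm{Id}$, and let $$D_{i,j}f(\eta)=\frac1{2\pi}\int_{-\pi}^{\pi}\bigl[f(R^{ij}_\theta\eta)-f(\eta)\bigr]\,d\theta .$$ The Kac walk with $n$ particles has generator $\mathcal L^*f=\frac1{2n}\sum_{i,j=1}^nD_{i,j}f$. For integers $d,N\ge1$ let $\Lambda_N=\{1,\dots,N\}^d$; the nearest-neighbour Kac walk on $\Lambda_N$, acting on functions of $\eta\in S^{N^d-1}(\omega)$ with coordinates indexed by $\Lambda_N$, has generator $$\mathcal L^{*,loc}f=\frac12\sum_{x\in\Lambda_N}\ \sum_{y\in\Lambda_N,\ \|x-y\|=1}D_{x,y}f,\qquad \|x-y\|=\sum_{i=1}^d|x_i-y_i| .$$ For either generator $\mathcal L$, with $\nu=\nu_{n,\omega}$ (and $n=N^d$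 in the local case), the spectral gap at energy $\omega$ is $$\inf\Bigl\{\frac{\nu(f(-\mathcal L)f)}{\nu(f^2)}\ :\ f\in L^2(\nu),\ \nu(f)=0,\ f\neq0\Bigr\}.$$ Let $\lambda^*(n)$ and $\lambda^{*,loc}(N)$ be the infima over $\omega>0$ of the spectral gaps of $\mathcal L^*$ and $\mathcal L^{*,loc}$, respectively. Then for all $d,N\ge1$ $$\lambda^{*,loc}(N)\ \ge\ \frac{1}{96\,d\,N^2}\,\lambda^*(N^d).$$ Moreover, for all $d\ge1$ and $N\ge2$ one has $\lambda^*(N^d)\ge\frac14$, and therefore $$\lambda^{*,loc}(N)\ \ge\ \frac1{384\,d\,N^2}.$$ -/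

import Mathlib

open MeasureTheory

noncomputable section

/-- The uniform probability measure on the sphere `{η ∈ ℝ^ι : ∑ i, η i ^ 2 = ω}` of radius `√ω`,
regarded as a measure on the ambient Euclidean space: the normalised surface measure of the unit
sphere, transported by the dilation `u ↦ √ω • u`. -/
def sphereUniform (ι : Type) [Fintype ι] (ω : ℝ) : Measure (EuclideanSpace ℝ ι) :=
  ((volume : Measure (EuclideanSpace ℝ ι)).toSphere Set.univ)⁻¹ •
    (volume : Measure (EuclideanSpace ℝ ι)).toSphere.map
      (fun u : Metric.sphere (0 : EuclideanSpace ℝ ι) 1 => √ω • (u : EuclideanSpace ℝ ι))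

/-- Clockwise rotation by the angle `θ` in the `(η i, η j)` plane; the identity if `i = j`. -/
def planeRotation {ι : Type} [DecidableEq ι] (i j : ι) (θ : ℝ) (η : EuclideanSpace ℝ ι) :
    EuclideanSpace ℝ ι :=
  WithLp.toLp 2 fun k =>
    if i = j then η k
    else if k = i then Real.cos θ * η i + Real.sin θ * η j
    else if k = j then -Real.sin θ * η i + Real.cos θ * η j
    else η k

/-- The pair collision operator
`D_{i,j} f (η) = (1/2π) ∫_{-π}^{π} [f (R^{ij}_θ η) - f η] dθ`. -/
def collisionOp {ι : Type} [DecidableEq ι] (i j : ι) (f : EuclideanSpace ℝ ι → ℝ)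
    (η : EuclideanSpace ℝ ι) : ℝ :=
  1 / (2 * Real.pi) * ∫ θ in (-Real.pi)..Real.pi, (f (planeRotation i j θ η) - f η)

/-- The generator of the Kac walk with `n` particles,
`(1/2n) ∑_{i,j} D_{i,j} f`. -/
def kacGenerator (n : ℕ) (f : EuclideanSpace ℝ (Fin n) → ℝ) (η : EuclideanSpace ℝ (Fin n)) : ℝ :=
  1 / (2 * (n : ℝ)) * ∑ i, ∑ j, collisionOp i j f η

/-- The cube `{1, …, N}^d`; the element `k` of `Fin N` stands for the coordinate `k + 1`. -/
abbrev Cube (d N : ℕ) : Type := Fin d → Fin N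

/-- The `ℓ¹` distance `∑ i, |x i - y i|` on the cube. -/
def Cube.dist {d N : ℕ} (x y : Cube d N) : ℤ :=
  ∑ i, |((x i : ℕ) : ℤ) - ((y i : ℕ) : ℤ)|

/-- The generator of the nearest-neighbour Kac walk on the cube `{1, …, N}^d`,
`(1/2) ∑_x ∑_{y : ‖x - y‖ = 1} D_{x,y} f`. -/
def kacLocGenerator (d N : ℕ) (f : EuclideanSpace ℝ (Cube d N) → ℝ)
    (η : EuclideanSpace ℝ (Cube d N)) : ℝ :=
  1 / 2 * ∑ x : Cube d N, ∑ y : Cube d N with Cube.dist x y = 1, collisionOp x y f η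

/-- The spectral gap of `-L` on `L²(ν)`: the infimum of `ν(f (-L) f) / ν(f²)` over
the nonzero `f ∈ L²(ν)` with `ν(f) = 0`. -/
def spectralGap {Ω : Type} [MeasurableSpace Ω] (ν : Measure Ω) (L : (Ω → ℝ) → (Ω → ℝ)) : ℝ :=
  sInf {r : ℝ | ∃ f : Ω → ℝ, MemLp f 2 ν ∧ ∫ η, f η ∂ν = 0 ∧ ∫ η, f η ^ 2 ∂ν ≠ 0 ∧
    r = (∫ η, f η * (-(L f η)) ∂ν) / ∫ η, f η ^ 2 ∂ν}

/-- `λ^*(n)`: the infimum over the energies `ω > 0` of the spectral gap of the Kac walk with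
`n` particles. -/
def kacGap (n : ℕ) : ℝ :=
  ⨅ ω : {ω : ℝ // 0 < ω}, spectralGap (sphereUniform (Fin n) ω) (kacGenerator n)

/-- `λ^{*,loc}(N)`: the infimum over the energies `ω > 0` of the spectral gap of the
nearest-neighbour Kac walk on the cube `{1, …, N}^d`. -/
def kacLocGap (d N : ℕ) : ℝ :=
  ⨅ ω : {ω : ℝ // 0 < ω}, spectralGap (sphereUniform (Cube d N) ω) (kacLocGenerator d N)

end

/-! Write `E_ij` for averaging over the rotations in the plane `(i, j)`. It is the orthogonal
projection of `L²(ν)` onto the functions invariant under these rotations, so `-D_ij = 1 - E_ij` is a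
projection and both Dirichlet forms are weighted sums of `‖f - E_ij f‖²`.

Mean-field bound. Let `A` be the sum of `1 - E_ij` over ordered pairs, so that `-L* = A / (2n)`. It
suffices to show `A² ≥ (n/2) A`: then `A ≥ n/2` off its kernel, and the kernel consists of the
constants because the plane rotations act ergodically on the sphere
(`eq_zero_of_rotation_invariant`). In the expansion of `A²`, disjoint pairs commute and contribute
nonnegatively, while overlapping pairs are grouped into triples. All then rests on three particles
(`three_particle_gap`): off the functions invariant under the triple, `E_ij + E_jk + E_ik ≤ 7/4`.
Averaging a monomial over one pair leaves a polynomial in the third coordinate with invariant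
coefficients, so only powers of single coordinates matter. In degree `m`, modulo lower degrees, the
sum acts on the three powers as the matrix with `1` on the diagonal and `κ_m` off it, with
eigenvalues `1 - κ_m` and `1 + 2κ_m`. Since `κ_m` is a signed moment of `cos`, both are at most
`7/4`.

Local bound. A quarter turn in the plane `(x, y)` exchanges the two particles up to a sign and fixes
`E_xy f`. Hence `a x y = ‖f - E_xy f‖` obeys `a x z ≤ 2 a x y + a y z`
(`norm_sub_rotAverage_triangle`). Moving a particle along lattice paths, one direction after
another, with Cauchy–Schwarz and path counting, bounds the sum over all pairs by `16 d N² N^d` times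
the sum over neighbours (`sum_pairs_le_sum_neighbours`). -/

noncomputable section

set_option linter.unusedSectionVars false

open scoped InnerProductSpace ENNReal Pointwise

/-! ### Invariance of the uniform measure under linear isometries. -/

section SphereMeasure

variable {ι κ : Type} [Fintype ι] [Fintype κ]

/-- The restriction of a linear isometry to the unit spheres. -/
def sphereMap (Φ : EuclideanSpace ℝ ι ≃ₗᵢ[ℝ] EuclideanSpace ℝ κ)
    (u : Metric.sphere (0 : EuclideanSpace ℝ ι) 1) : Metric.sphere (0 : EuclideanSpace ℝ κ) 1 :=
  ⟨Φ u, by simp⟩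

lemma continuous_sphereMap (Φ : EuclideanSpace ℝ ι ≃ₗᵢ[ℝ] EuclideanSpace ℝ κ) :
    Continuous (sphereMap Φ) := by
  unfold sphereMap
  fun_prop

/-- The surface measure of a set is read off from the volume of the cone over it, and isometries
carry cones to cones and preserve volume. -/
lemma map_toSphere (Φ : EuclideanSpace ℝ ι ≃ₗᵢ[ℝ] EuclideanSpace ℝ κ) :
    (volume : Measure (EuclideanSpace ℝ ι)).toSphere.map (sphereMap Φ) =
      (volume : Measure (EuclideanSpace ℝ κ)).toSphere := by
  ext s hs
  have hm : Measurable (sphereMap Φ) := (continuous_sphereMap Φ).measurable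
  rw [Measure.map_apply hm hs, Measure.toSphere_apply' _ (hm hs), Measure.toSphere_apply' _ hs,
    LinearEquiv.finrank_eq Φ.toLinearEquiv]
  have hset : Set.Ioo (0 : ℝ) 1 • (Subtype.val '' (sphereMap Φ ⁻¹' s)) =
      Φ ⁻¹' (Set.Ioo (0 : ℝ) 1 • (Subtype.val '' s)) := by
    ext x
    simp only [Set.mem_smul, Set.mem_image, Set.mem_preimage]
    constructor
    · rintro ⟨r, hr, _, ⟨u, hu, rfl⟩, rfl⟩
      exact ⟨r, hr, _, ⟨_, hu, rfl⟩, by simp [sphereMap]⟩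
    · rintro ⟨r, hr, _, ⟨u, hu, rfl⟩, hx⟩
      refine ⟨r, hr, Φ.symm u, ⟨⟨Φ.symm u, by simp⟩, by simpa [sphereMap] using hu, rfl⟩, ?_⟩
      rw [← map_smul, hx, Φ.symm_apply_apply]
  have hpre : (volume : Measure (EuclideanSpace ℝ ι)) (Φ ⁻¹' (Set.Ioo (0 : ℝ) 1 •
      (Subtype.val '' s))) = (volume : Measure (EuclideanSpace ℝ κ))
        (Set.Ioo (0 : ℝ) 1 • (Subtype.val '' s)) :=
    (Φ.measurePreserving).measure_preimage_equiv (f := Φ.toHomeomorph.toMeasurableEquiv) _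
  rw [hset, hpre]

/-- Two index types are allowed so that the same statement serves rotations, the antipodal map and
relabelling of particles. -/
lemma map_sphereUniform (Φ : EuclideanSpace ℝ ι ≃ₗᵢ[ℝ] EuclideanSpace ℝ κ) (ω : ℝ) :
    (sphereUniform ι ω).map Φ = sphereUniform κ ω := by
  have hc : Continuous fun u : Metric.sphere (0 : EuclideanSpace ℝ ι) 1 =>
    √ω • (u : EuclideanSpace ℝ ι) := by fun_prop
  have hc' : Continuous fun u : Metric.sphere (0 : EuclideanSpace ℝ κ) 1 =>
    √ω • (u : EuclideanSpace ℝ κ) := by fun_prop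
  have huniv : (volume : Measure (EuclideanSpace ℝ ι)).toSphere Set.univ =
      (volume : Measure (EuclideanSpace ℝ κ)).toSphere Set.univ := by
    rw [← map_toSphere Φ, Measure.map_apply (continuous_sphereMap Φ).measurable MeasurableSet.univ,
      Set.preimage_univ]
  unfold sphereUniform
  rw [Measure.map_smul, Measure.map_map Φ.continuous.measurable hc.measurable, huniv,
    ← map_toSphere Φ, Measure.map_map hc'.measurable (continuous_sphereMap Φ).measurable]
  congr 2
  ext u
  simp [sphereMap]

lemma measurePreserving_sphereUniform (Φ : EuclideanSpace ℝ ι ≃ₗᵢ[ℝ] EuclideanSpace ℝ κ) (ω : ℝ) :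
    MeasurePreserving Φ (sphereUniform ι ω) (sphereUniform κ ω) :=
  ⟨Φ.continuous.measurable, map_sphereUniform Φ ω⟩

instance isProbabilityMeasure_sphereUniform [Nonempty ι] (ω : ℝ) :
    IsProbabilityMeasure (sphereUniform ι ω) := by
  constructor
  have hc : Continuous fun u : Metric.sphere (0 : EuclideanSpace ℝ ι) 1 =>
    √ω • (u : EuclideanSpace ℝ ι) := by fun_prop
  unfold sphereUniform
  rw [Measure.smul_apply, Measure.map_apply hc.measurable MeasurableSet.univ, Set.preimage_univ,
    smul_eq_mul]
  refine ENNReal.inv_mul_cancel ?_ (measure_ne_top _ _)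
  rw [Ne, Measure.measure_univ_eq_zero]
  exact Measure.toSphere_ne_zero _

lemma ae_norm_eq (ω : ℝ) : ∀ᵐ η ∂(sphereUniform ι ω), ‖η‖ = √ω := by
  have hc : Continuous fun u : Metric.sphere (0 : EuclideanSpace ℝ ι) 1 =>
    √ω • (u : EuclideanSpace ℝ ι) := by fun_prop
  unfold sphereUniform
  refine Measure.ae_smul_measure ?_ _
  refine (ae_map_iff hc.measurable.aemeasurable ?_).2 (Filter.Eventually.of_forall fun u => ?_)
  · exact (isClosed_eq continuous_norm continuous_const).measurableSet
  · simp [norm_smul, abs_of_nonneg (Real.sqrt_nonneg ω)]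

end SphereMeasure

/-! ### Algebra of the plane rotations. -/

section Rotation

variable {ι : Type} [DecidableEq ι]

@[simp] lemma planeRotation_self (i : ι) (θ : ℝ) (η : EuclideanSpace ℝ ι) :
    planeRotation i i θ η = η := by
  ext k
  simp [planeRotation]

lemma planeRotation_left {i j : ι} (h : i ≠ j) (θ : ℝ) (η : EuclideanSpace ℝ ι) :
    planeRotation i j θ η i = Real.cos θ * η i + Real.sin θ * η j := by
  simp [planeRotation, h]

lemma planeRotation_right {i j : ι} (h : i ≠ j) (θ : ℝ) (η : EuclideanSpace ℝ ι) :
    planeRotation i j θ η j = -Real.sin θ * η i + Real.cos θ * η j := by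
  simp [planeRotation, h, h.symm]

lemma planeRotation_of_ne {i j k : ι} (hi : k ≠ i) (hj : k ≠ j) (θ : ℝ) (η : EuclideanSpace ℝ ι) :
    planeRotation i j θ η k = η k := by
  simp [planeRotation, hi, hj]

lemma planeRotation_zero (i j : ι) (η : EuclideanSpace ℝ ι) : planeRotation i j 0 η = η := by
  ext k
  by_cases hij : i = j
  · simp [planeRotation, hij]
  · by_cases hi : k = i
    · subst hi; simp [planeRotation]
    · by_cases hj : k = j
      · subst hj; simp [planeRotation, hi]
      · simp [planeRotation, hi, hj]

lemma planeRotation_planeRotation (i j : ι) (θ φ : ℝ) (η : EuclideanSpace ℝ ι) :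
    planeRotation i j θ (planeRotation i j φ η) = planeRotation i j (θ + φ) η := by
  by_cases hij : i = j
  · subst hij; simp
  · ext k
    by_cases hi : k = i
    · subst hi
      simp only [planeRotation_left hij, planeRotation_right hij, Real.cos_add, Real.sin_add]
      ring
    · by_cases hj : k = j
      · subst hj
        simp only [planeRotation_left hij, planeRotation_right hij, Real.cos_add, Real.sin_add]
        ring
      · simp only [planeRotation_of_ne hi hj]

lemma planeRotation_comm (i j : ι) (θ : ℝ) (η : EuclideanSpace ℝ ι) :
    planeRotation j i θ η = planeRotation i j (-θ) η := by
  by_cases hij : i = j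
  · subst hij; simp
  · ext k
    by_cases hi : k = i
    · subst hi
      simp only [planeRotation_left hij, planeRotation_right (Ne.symm hij), Real.cos_neg,
        Real.sin_neg]
      ring
    · by_cases hj : k = j
      · subst hj
        simp only [planeRotation_right hij, planeRotation_left (Ne.symm hij), Real.cos_neg,
          Real.sin_neg]
        ring
      · simp only [planeRotation_of_ne hi hj, planeRotation_of_ne hj hi]

lemma planeRotation_disjoint_comm {i j k l : ι} (hik : i ≠ k) (hil : i ≠ l) (hjk : j ≠ k)
    (hjl : j ≠ l) (θ φ : ℝ) (η : EuclideanSpace ℝ ι) :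
    planeRotation i j θ (planeRotation k l φ η) = planeRotation k l φ (planeRotation i j θ η) := by
  ext m
  simp only [planeRotation]
  split_ifs <;> simp_all

/-- Signed transposition conjugates the rotations in the plane `(y, z)` to the rotations in the
plane `(x, z)`. -/
lemma planeRotation_conj {x y z : ι} (hxy : x ≠ y) (hxz : x ≠ z) (hyz : y ≠ z) (θ : ℝ)
    (η : EuclideanSpace ℝ ι) :
    planeRotation x y (Real.pi / 2) (planeRotation x z θ η) =
      planeRotation y z (-θ) (planeRotation x y (Real.pi / 2) η) := by
  ext m
  by_cases hx : m = x
  · subst hx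
    rw [planeRotation_left hxy, planeRotation_of_ne hxy hxz, planeRotation_left hxy,
      planeRotation_left hxz, planeRotation_of_ne (Ne.symm hxy) hyz]
    simp
  by_cases hy : m = y
  · subst hy
    rw [planeRotation_right hxy, planeRotation_left hyz, planeRotation_left hxz,
      planeRotation_of_ne (Ne.symm hxy) hyz, planeRotation_right hxy,
      planeRotation_of_ne (Ne.symm hxz) (Ne.symm hyz)]
    simp
    ring
  by_cases hz : m = z
  · subst hz
    rw [planeRotation_of_ne hx hy, planeRotation_right hxz, planeRotation_right hyz,
      planeRotation_right hxy, planeRotation_of_ne hx hy]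
    simp
  · rw [planeRotation_of_ne hx hy, planeRotation_of_ne hx hz, planeRotation_of_ne hy hz,
      planeRotation_of_ne hx hy]

lemma planeRotation_add_two_pi (i j : ι) (θ : ℝ) (η : EuclideanSpace ℝ ι) :
    planeRotation i j (θ + 2 * Real.pi) η = planeRotation i j θ η := by
  simp [planeRotation]

/-- The rotation in a coordinate plane as a linear isometry. -/
def planeRotationEquiv [Fintype ι] (i j : ι) (θ : ℝ) :
    EuclideanSpace ℝ ι ≃ₗᵢ[ℝ] EuclideanSpace ℝ ι where
  toFun := planeRotation i j θ
  invFun := planeRotation i j (-θ)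
  left_inv η := by simp [planeRotation_planeRotation, planeRotation_zero]
  right_inv η := by simp [planeRotation_planeRotation, planeRotation_zero]
  map_add' η ζ := by
    ext k
    simp only [planeRotation, PiLp.add_apply]
    split_ifs <;> ring
  map_smul' c η := by
    ext k
    simp only [planeRotation, PiLp.smul_apply, smul_eq_mul, RingHom.id_apply]
    split_ifs <;> ring
  norm_map' η := by
    change ‖planeRotation i j θ η‖ = ‖η‖
    by_cases hij : i = j
    · subst hij; simp
    · rw [EuclideanSpace.norm_eq, EuclideanSpace.norm_eq]
      congr 1
      have hj : j ∈ Finset.univ.erase i := by simp [Ne.symm hij]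
      rw [← Finset.add_sum_erase _ _ (Finset.mem_univ i), ← Finset.add_sum_erase _ _ hj,
        ← Finset.add_sum_erase _ _ (Finset.mem_univ i), ← Finset.add_sum_erase _ _ hj]
      rw [← add_assoc, ← add_assoc]
      congr 1
      · simp only [planeRotation_left hij, planeRotation_right hij, Real.norm_eq_abs, sq_abs]
        nlinarith [Real.sin_sq_add_cos_sq θ]
      · refine Finset.sum_congr rfl fun k hk => ?_
        simp only [Finset.mem_erase, Finset.mem_univ, and_true] at hk
        rw [planeRotation_of_ne hk.2 hk.1]

@[simp] lemma coe_planeRotationEquiv [Fintype ι] (i j : ι) (θ : ℝ) :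
    ⇑(planeRotationEquiv i j θ) = planeRotation i j θ := rfl

lemma measurePreserving_planeRotation [Fintype ι] (i j : ι) (θ ω : ℝ) :
    MeasurePreserving (planeRotation i j θ) (sphereUniform ι ω) (sphereUniform ι ω) :=
  measurePreserving_sphereUniform (planeRotationEquiv i j θ) ω

@[simp] lemma norm_planeRotation [Fintype ι] (i j : ι) (θ : ℝ) (η : EuclideanSpace ℝ ι) :
    ‖planeRotation i j θ η‖ = ‖η‖ :=
  (planeRotationEquiv i j θ).norm_map η

lemma continuous_planeRotation [Fintype ι] (i j : ι) :
    Continuous fun p : ℝ × EuclideanSpace ℝ ι => planeRotation i j p.1 p.2 := by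
  unfold planeRotation
  refine (PiLp.continuous_toLp 2 _).comp (continuous_pi fun k => ?_)
  split_ifs <;> fun_prop

end Rotation

/-! ### Spectral bounds for symmetric operators. -/

section Hilbert

variable {H : Type*} [NormedAddCommGroup H] [InnerProductSpace ℝ H]

/-- If `A` is symmetric and nonnegative with `‖A h‖² ≥ c ⟪h, A h⟫`, then `A ≥ c` on the range
of `A`. -/
lemma le_inner_apply_of_range {A : H →L[ℝ] H} (hs : ∀ x y, ⟪A x, y⟫_ℝ = ⟪x, A y⟫_ℝ)
    (hpos : ∀ x, 0 ≤ ⟪x, A x⟫_ℝ) {c : ℝ} (hc : ∀ x, c * ⟪x, A x⟫_ℝ ≤ ‖A x‖ ^ 2) (hc0 : 0 < c) (h : H) :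
    c * ‖A h‖ ^ 2 ≤ ⟪A h, A (A h)⟫_ℝ := by
  -- Cauchy–Schwarz for the semidefinite form `⟪·, A ·⟫` at `h` and `A h`, through the discriminant.
  have hcs : ‖A h‖ ^ 2 * ‖A h‖ ^ 2 ≤ ⟪h, A h⟫_ℝ * ⟪A h, A (A h)⟫_ℝ := by
    have hq : ∀ t : ℝ, 0 ≤ ⟪A h, A (A h)⟫_ℝ * (t * t) + (2 * ‖A h‖ ^ 2) * t + ⟪h, A h⟫_ℝ := by
      intro t
      have := hpos (h + t • A h)
      have e : ⟪h, A (A h)⟫_ℝ = ‖A h‖ ^ 2 := by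
        rw [← hs, real_inner_self_eq_norm_sq]
      have e' : ⟪A h, A h⟫_ℝ = ‖A h‖ ^ 2 := real_inner_self_eq_norm_sq _
      simp only [map_add, map_smul, inner_add_left, inner_add_right, real_inner_smul_left,
        real_inner_smul_right, e, e'] at this
      linarith
    have := discrim_le_zero hq
    unfold discrim at this
    nlinarith
  by_cases h0 : ‖A h‖ ^ 2 = 0
  · rw [h0, mul_zero]; exact hpos _
  · have hp : 0 < ‖A h‖ ^ 2 := lt_of_le_of_ne (sq_nonneg _) (Ne.symm h0)
    have h1 := mul_le_mul_of_nonneg_right (hc h) (hpos (A h))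
    have h2 := mul_le_mul_of_nonneg_left hcs hc0.le
    have h3 : ‖A h‖ ^ 2 * (c * ‖A h‖ ^ 2) ≤ ‖A h‖ ^ 2 * ⟪A h, A (A h)⟫_ℝ := by nlinarith
    exact le_of_mul_le_mul_left h3 hp

/-- A nonnegative symmetric operator with `‖A h‖² ≥ c ⟪h, A h⟫` has a spectral gap `c` above its
kernel. -/
lemma le_inner_apply_of_orthogonal_ker [CompleteSpace H] {A : H →L[ℝ] H}
    (hs : ∀ x y, ⟪A x, y⟫_ℝ = ⟪x, A y⟫_ℝ)
    (hpos : ∀ x, 0 ≤ ⟪x, A x⟫_ℝ) {c : ℝ} (hc : ∀ x, c * ⟪x, A x⟫_ℝ ≤ ‖A x‖ ^ 2) (hc0 : 0 < c)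
    {f : H} (hf : ∀ g, A g = 0 → ⟪f, g⟫_ℝ = 0) : c * ‖f‖ ^ 2 ≤ ⟪f, A f⟫_ℝ := by
  have hsa : IsSelfAdjoint A :=
    ContinuousLinearMap.isSelfAdjoint_iff_isSymmetric.2 fun x y => hs x y
  -- The closure of the range of a self-adjoint operator is the orthogonal complement of its kernel.
  have hmem : f ∈ A.range.topologicalClosure := by
    have h := A.orthogonal_ker
    rw [hsa.adjoint_eq] at h
    rw [← h, Submodule.mem_orthogonal']
    intro g hg
    exact hf g (by simpa using hg)
  have hcl : IsClosed {f : H | c * ‖f‖ ^ 2 ≤ ⟪f, A f⟫_ℝ} :=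
    isClosed_le (by fun_prop) (by fun_prop)
  have hsub : (A.range : Set H) ⊆ {f : H | c * ‖f‖ ^ 2 ≤ ⟪f, A f⟫_ℝ} := by
    rintro _ ⟨h, rfl⟩
    exact le_inner_apply_of_range hs hpos hc hc0 h
  exact closure_minimal hsub hcl hmem

/-- A vector killed by `(A - α) (A - β)` has Rayleigh quotient between `α` and `β`. -/
lemma inner_apply_le_of_quadratic {A : H →L[ℝ] H} (hs : ∀ x y, ⟪A x, y⟫_ℝ = ⟪x, A y⟫_ℝ)
    {α β C : ℝ} (hα : α ≤ C) (hβ : β ≤ C) {f : H}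
    (hf : A (A f) - (α + β) • A f + (α * β) • f = 0) : ⟪f, A f⟫_ℝ ≤ C * ‖f‖ ^ 2 := by
  by_cases h0 : f = 0
  · simp [h0]
  have hp : 0 < ‖f‖ ^ 2 := by positivity
  have h1 : ‖A f‖ ^ 2 - (α + β) * ⟪f, A f⟫_ℝ + α * β * ‖f‖ ^ 2 = 0 := by
    have := congrArg (fun v => ⟪f, v⟫_ℝ) hf
    simp only [inner_add_right, inner_sub_right, real_inner_smul_right, inner_zero_right,
      real_inner_self_eq_norm_sq] at this
    rwa [← hs, real_inner_self_eq_norm_sq] at this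
  have h2 : ⟪f, A f⟫_ℝ * ⟪f, A f⟫_ℝ ≤ ‖f‖ ^ 2 * ‖A f‖ ^ 2 := by
    have := real_inner_mul_inner_self_le f (A f)
    simpa [real_inner_self_eq_norm_sq] using this
  set t := ⟪f, A f⟫_ℝ
  set n := ‖f‖ ^ 2
  have h3 : (t - α * n) * (t - β * n) ≤ 0 := by nlinarith
  by_contra hcon
  push Not at hcon
  have h4 : 0 < t - α * n := by nlinarith
  have h5 : 0 < t - β * n := by nlinarith
  nlinarith [mul_pos h4 h5]

lemma mem_closure_of_mapsTo {A : H →L[ℝ] H} {F G : Submodule ℝ H} (h : ∀ x ∈ F, A x ∈ G) {x : H}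
    (hx : x ∈ F.topologicalClosure) : A x ∈ G.topologicalClosure :=
  map_mem_closure A.continuous hx h

/-- Induction on the level: split `f` into its projection `g` on the closure of `F m` and a
remainder `u`. The vector `(A - α)(A - β) u` lies in that closure by `hstep` and is orthogonal to it
because `A` is symmetric and preserves it, so it vanishes. The quadratic form has no cross terms
between `u` and `g`. -/
lemma inner_apply_le_of_mem_filtration [CompleteSpace H] {A : H →L[ℝ] H}
    (hs : ∀ x y, ⟪A x, y⟫_ℝ = ⟪x, A y⟫_ℝ)
    {F : ℕ → Submodule ℝ H} (hmono : ∀ m, F m ≤ F (m + 1)) (hA : ∀ m, ∀ x ∈ F m, A x ∈ F m)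
    {α β : ℕ → ℝ} {C : ℝ} (hα : ∀ m, α m ≤ C) (hβ : ∀ m, β m ≤ C)
    (hstep : ∀ m, ∀ x ∈ F (m + 1), A (A x) - (α m + β m) • A x + (α m * β m) • x ∈ F m)
    (m : ℕ) : ∀ f ∈ (F m).topologicalClosure, (∀ x ∈ F 0, ⟪x, f⟫_ℝ = 0) →
      ⟪f, A f⟫_ℝ ≤ C * ‖f‖ ^ 2 := by
  induction m with
  | zero =>
    intro f hf hf0
    have hcl : (F 0).topologicalClosure ≤ (ℝ ∙ f)ᗮ := by
      refine Submodule.topologicalClosure_minimal _ (fun x hx => ?_)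
        (Submodule.isClosed_orthogonal _)
      rw [Submodule.mem_orthogonal_singleton_iff_inner_left]
      exact hf0 x hx
    have h := (Submodule.mem_orthogonal_singleton_iff_inner_left).1 (hcl hf)
    rw [inner_self_eq_zero] at h
    simp [h]
  | succ m ih =>
    intro f hf hf0
    have hF0 : F 0 ≤ F m := (monotone_nat_of_le_succ hmono) (Nat.zero_le m)
    have : CompleteSpace (F m).topologicalClosure :=
      (Submodule.isClosed_topologicalClosure _).completeSpace_coe
    set G := (F m).topologicalClosure with hG
    set g := G.starProjection f with hg
    set u := f - g with hu
    have hgG : g ∈ G := G.starProjection_apply_mem f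
    have huG : ∀ x ∈ G, ⟪u, x⟫_ℝ = 0 := fun x hx => G.starProjection_inner_eq_zero f x hx
    have hAG : ∀ x ∈ G, A x ∈ G := fun x hx => mem_closure_of_mapsTo (hA m) hx
    have hg0 : ∀ x ∈ F 0, ⟪x, g⟫_ℝ = 0 := by
      intro x hx
      have h1 := huG x (Submodule.le_topologicalClosure _ (hF0 hx))
      rw [real_inner_comm, hu, inner_sub_right, hf0 x hx] at h1
      linarith
    have hucl : u ∈ (F (m + 1)).topologicalClosure :=
      Submodule.sub_mem _ hf (Submodule.topologicalClosure_mono (hmono m) hgG)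
    have hquad : A (A u) - (α m + β m) • A u + (α m * β m) • u = 0 := by
      set T : H →L[ℝ] H := A ∘L A - (α m + β m) • A + (α m * β m) • ContinuousLinearMap.id ℝ H
      have hT : T u ∈ G := mem_closure_of_mapsTo (A := T) (fun x hx => hstep m x hx) hucl
      have hT' : ∀ x ∈ G, ⟪T u, x⟫_ℝ = 0 := by
        intro x hx
        change ⟪A (A u) - (α m + β m) • A u + (α m * β m) • u, x⟫_ℝ = 0
        simp only [inner_add_left, inner_sub_left, real_inner_smul_left, hs]
        rw [huG _ (hAG _ (hAG _ hx)), huG _ (hAG _ hx), huG _ hx]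
        simp
      have := hT' _ hT
      rwa [inner_self_eq_zero] at this
    have h1 := inner_apply_le_of_quadratic hs (hα m) (hβ m) hquad
    have h2 := ih g hgG hg0
    have hf' : f = u + g := by simp [hu]
    have hAu : ⟪g, A u⟫_ℝ = 0 := by rw [← hs, real_inner_comm]; exact huG _ (hAG _ hgG)
    have hn : ‖f‖ ^ 2 = ‖u‖ ^ 2 + ‖g‖ ^ 2 := by
      rw [hf', norm_add_sq_real, huG g hgG]; ring
    have hq : ⟪f, A f⟫_ℝ = ⟪u, A u⟫_ℝ + ⟪g, A g⟫_ℝ := by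
      rw [hf', map_add, inner_add_left, inner_add_right, inner_add_right, hAu,
        huG _ (hAG _ hgG)]
      ring
    rw [hn, hq]
    linarith

/-- A symmetric operator which acts on the quotients of a filtration with eigenvalues at most `C`,
and maps into the closure of the union of the filtration, is at most `C` on the orthogonal
complement of the bottom of the filtration. -/
lemma inner_apply_le_of_filtration [CompleteSpace H] {A : H →L[ℝ] H}
    (hs : ∀ x y, ⟪A x, y⟫_ℝ = ⟪x, A y⟫_ℝ)
    {F : ℕ → Submodule ℝ H} (hmono : ∀ m, F m ≤ F (m + 1)) (hA : ∀ m, ∀ x ∈ F m, A x ∈ F m)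
    {α β : ℕ → ℝ} {C : ℝ} (hC : 0 ≤ C) (hα : ∀ m, α m ≤ C) (hβ : ∀ m, β m ≤ C)
    (hstep : ∀ m, ∀ x ∈ F (m + 1), A (A x) - (α m + β m) • A x + (α m * β m) • x ∈ F m)
    (hrange : ∀ x, A x ∈ (⨆ m, F m).topologicalClosure) {f : H} (hf0 : ∀ x ∈ F 0, ⟪x, f⟫_ℝ = 0) :
    ⟪f, A f⟫_ℝ ≤ C * ‖f‖ ^ 2 := by
  have hmono' : Monotone F := monotone_nat_of_le_succ hmono
  have h1 : CompleteSpace (⨆ m, F m).topologicalClosure :=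
    (Submodule.isClosed_topologicalClosure _).completeSpace_coe
  have h2 : CompleteSpace (F 0).topologicalClosure :=
    (Submodule.isClosed_topologicalClosure _).completeSpace_coe
  set S := (⨆ m, F m).topologicalClosure
  set Z := (F 0).topologicalClosure
  have hZ : ∀ g : H, ∀ x ∈ F 0, ⟪x, g - Z.starProjection g⟫_ℝ = 0 := by
    intro g x hx
    rw [real_inner_comm]
    exact Z.starProjection_inner_eq_zero g x (Submodule.le_topologicalClosure _ hx)
  -- Phrased for `g - Z g`, the bound is a closed condition on all `g`, so it passes from the union
  -- of the filtration to its closure.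
  have hcl : IsClosed {g : H | ⟪g - Z.starProjection g, A (g - Z.starProjection g)⟫_ℝ ≤
      C * ‖g - Z.starProjection g‖ ^ 2} := isClosed_le (by fun_prop) (by fun_prop)
  have hsub : ((⨆ m, F m : Submodule ℝ H) : Set H) ⊆
      {g : H | ⟪g - Z.starProjection g, A (g - Z.starProjection g)⟫_ℝ ≤
      C * ‖g - Z.starProjection g‖ ^ 2} := by
    intro g hg
    obtain ⟨m, hm⟩ := (Submodule.mem_iSup_of_directed F hmono'.directed_le).1 hg
    refine inner_apply_le_of_mem_filtration hs hmono hA hα hβ hstep m _ ?_ (hZ g)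
    refine Submodule.sub_mem _ (Submodule.le_topologicalClosure _ hm) ?_
    exact Submodule.topologicalClosure_mono (hmono' (Nat.zero_le m)) (Z.starProjection_apply_mem g)
  set g := S.starProjection f with hg
  set u := f - g with hu
  have hgS : g ∈ S := S.starProjection_apply_mem f
  have huS : ∀ x ∈ S, ⟪u, x⟫_ℝ = 0 := fun x hx => S.starProjection_inner_eq_zero f x hx
  have hF0S : F 0 ≤ S := (le_iSup F 0).trans (Submodule.le_topologicalClosure _)
  have hg0 : ∀ x ∈ F 0, ⟪x, g⟫_ℝ = 0 := by
    intro x hx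
    have h1 := huS x (hF0S hx)
    rw [real_inner_comm, hu, inner_sub_right, hf0 x hx] at h1
    linarith
  have hPg : Z.starProjection g = 0 := by
    rw [Submodule.starProjection_apply_eq_zero_iff, Submodule.orthogonal_closure,
      Submodule.mem_orthogonal]
    exact hg0
  have hmain : ⟪g, A g⟫_ℝ ≤ C * ‖g‖ ^ 2 := by
    have := closure_minimal hsub hcl hgS
    simpa [hPg] using this
  -- `u` is orthogonal to `S`, which contains the range of `A`.
  have hAu : A u = 0 := by
    have h1 : ⟪A u, A u⟫_ℝ = 0 := by
      rw [hs]; exact huS _ (hrange _)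
    rwa [inner_self_eq_zero] at h1
  have hf' : f = u + g := by simp [hu]
  have hn : ‖f‖ ^ 2 = ‖u‖ ^ 2 + ‖g‖ ^ 2 := by
    rw [hf', norm_add_sq_real, huS g hgS]; ring
  have hq : ⟪f, A f⟫_ℝ = ⟪g, A g⟫_ℝ := by
    rw [hf', map_add, hAu, zero_add, inner_add_left, huS _ (hrange _), zero_add]
  rw [hn, hq]
  nlinarith [mul_nonneg hC (sq_nonneg ‖u‖)]

end Hilbert

/-! ### Orthogonal projections that commute. -/

section Projections

variable {H : Type*} [NormedAddCommGroup H] [InnerProductSpace ℝ H]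

lemma norm_sub_starProjection_le (V : Submodule ℝ H) [V.HasOrthogonalProjection] (f : H) {v : H}
    (hv : v ∈ V) : ‖f - V.starProjection f‖ ≤ ‖f - v‖ := by
  rw [Submodule.starProjection_minimal]
  exact ciInf_le ⟨0, by rintro _ ⟨x, rfl⟩; exact norm_nonneg _⟩ (⟨v, hv⟩ : V)

lemma inner_sub_starProjection_self (V : Submodule ℝ H) [V.HasOrthogonalProjection] (f : H) :
    ⟪f, f - V.starProjection f⟫_ℝ = ‖f - V.starProjection f‖ ^ 2 := by
  have h := V.starProjection_inner_eq_zero f _ (V.starProjection_apply_mem f)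
  rw [← real_inner_self_eq_norm_sq]
  rw [inner_sub_right (f - V.starProjection f), h, sub_zero, real_inner_comm]

lemma starProjection_commute_isometry (V : Submodule ℝ H) [V.HasOrthogonalProjection]
    (U U' : H →ₗᵢ[ℝ] H) (hUU' : ∀ x, U (U' x) = x) (hU : ∀ x ∈ V, U x ∈ V) (hU' : ∀ x ∈ V, U' x ∈ V)
    (f : H) : V.starProjection (U f) = U (V.starProjection f) := by
  refine Submodule.eq_starProjection_of_mem_of_inner_eq_zero
    (hU _ (V.starProjection_apply_mem f)) fun w hw => ?_
  rw [← map_sub, ← hUU' w, U.inner_map_map]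
  exact V.starProjection_inner_eq_zero f _ (hU' w hw)

/-- Decompose `f = w + w'` along `W`. The `w` part of the first factor stays in `W`, hence is
orthogonal to `w'`, and the `w'` part contributes a square. -/
lemma inner_sub_starProjection_nonneg (V W : Submodule ℝ H) [V.HasOrthogonalProjection]
    [W.HasOrthogonalProjection] (h : ∀ x ∈ W, V.starProjection x ∈ W) (f : H) :
    0 ≤ ⟪f - V.starProjection f, f - W.starProjection f⟫_ℝ := by
  set w := W.starProjection f
  set w' := f - w with hw'
  have hw : w ∈ W := W.starProjection_apply_mem f
  have hperp : ∀ x ∈ W, ⟪w', x⟫_ℝ = 0 := fun x hx => W.starProjection_inner_eq_zero f x hx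
  have hf : f = w + w' := by simp [hw']
  have h1 : ⟪w - V.starProjection w, w'⟫_ℝ = 0 := by
    rw [real_inner_comm]; exact hperp _ (W.sub_mem hw (h w hw))
  have h2 : ⟪w' - V.starProjection w', w'⟫_ℝ = ‖w' - V.starProjection w'‖ ^ 2 := by
    rw [real_inner_comm]; exact inner_sub_starProjection_self V w'
  have : f - V.starProjection f = (w - V.starProjection w) + (w' - V.starProjection w') := by
    rw [hf, map_add]; abel
  rw [this, inner_add_left, h1, h2]
  positivity

end Projections

/-! ### Pair averages as projections on `L²`. -/

section Operators

variable {ι : Type} [Fintype ι]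

/-- The real Hilbert space of square-integrable functions on the sphere of energy `ω`. -/
abbrev SphereL2 (ι : Type) [Fintype ι] (ω : ℝ) : Type := Lp ℝ 2 (sphereUniform ι ω)

/-- The composition with a linear isometry as an operator on `L²`. -/
def isoOp {ω : ℝ} (Φ : EuclideanSpace ℝ ι ≃ₗᵢ[ℝ] EuclideanSpace ℝ ι) :
    SphereL2 ι ω →ₗᵢ[ℝ] SphereL2 ι ω :=
  Lp.compMeasurePreservingₗᵢ ℝ Φ (measurePreserving_sphereUniform Φ ω)

variable {ω : ℝ}

lemma coeFn_isoOp (Φ : EuclideanSpace ℝ ι ≃ₗᵢ[ℝ] EuclideanSpace ℝ ι) (f : SphereL2 ι ω) :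
    isoOp Φ f =ᵐ[sphereUniform ι ω] f ∘ Φ :=
  Lp.coeFn_compMeasurePreserving f (measurePreserving_sphereUniform Φ ω)

lemma isoOp_toLp (Φ : EuclideanSpace ℝ ι ≃ₗᵢ[ℝ] EuclideanSpace ℝ ι)
    {f : EuclideanSpace ℝ ι → ℝ} (hf : MemLp f 2 (sphereUniform ι ω)) :
    isoOp Φ hf.toLp = (hf.comp_measurePreserving (measurePreserving_sphereUniform Φ ω)).toLp :=
  Lp.toLp_compMeasurePreserving hf (measurePreserving_sphereUniform Φ ω)

lemma isoOp_isoOp (Φ Ψ : EuclideanSpace ℝ ι ≃ₗᵢ[ℝ] EuclideanSpace ℝ ι) (f : SphereL2 ι ω) :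
    isoOp Φ (isoOp Ψ f) = isoOp (Φ.trans Ψ) f :=
  (Lp.compMeasurePreserving_comp_apply f (measurePreserving_sphereUniform Ψ ω)
    (measurePreserving_sphereUniform Φ ω)).symm

lemma isoOp_symm_apply (Φ : EuclideanSpace ℝ ι ≃ₗᵢ[ℝ] EuclideanSpace ℝ ι) (f : SphereL2 ι ω) :
    isoOp Φ (isoOp Φ.symm f) = f := by
  rw [isoOp_isoOp, LinearIsometryEquiv.self_trans_symm]
  exact Lp.compMeasurePreserving_id_apply f

variable [DecidableEq ι]

/-- The subspace of `L²` functions invariant under the rotations in the `(i, j)` plane. -/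
def rotInvariants (ω : ℝ) (i j : ι) : Submodule ℝ (SphereL2 ι ω) :=
  ⨅ θ : ℝ, LinearMap.eqLocus (isoOp (planeRotationEquiv i j θ)).toLinearMap LinearMap.id

lemma mem_rotInvariants {i j : ι} {f : SphereL2 ι ω} :
    f ∈ rotInvariants ω i j ↔ ∀ θ, isoOp (planeRotationEquiv i j θ) f = f := by
  simp [rotInvariants, LinearMap.mem_eqLocus]

lemma isClosed_rotInvariants (i j : ι) :
    IsClosed (rotInvariants ω i j : Set (SphereL2 ι ω)) := by
  have : (rotInvariants ω i j : Set (SphereL2 ι ω)) =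
      ⋂ θ : ℝ, {f | isoOp (planeRotationEquiv i j θ) f = f} := by
    ext f
    simp [mem_rotInvariants]
  rw [this]
  exact isClosed_iInter fun θ => isClosed_eq (LinearIsometry.continuous _) continuous_id

instance completeSpace_rotInvariants (i j : ι) : CompleteSpace (rotInvariants ω i j) :=
  (isClosed_rotInvariants i j).completeSpace_coe

/-- The orthogonal projection on the functions invariant under rotations in the `(i, j)` plane. -/
def rotAverage (ω : ℝ) (i j : ι) : SphereL2 ι ω →L[ℝ] SphereL2 ι ω :=
  (rotInvariants ω i j).starProjection

lemma rotAverage_mem (i j : ι) (f : SphereL2 ι ω) : rotAverage ω i j f ∈ rotInvariants ω i j :=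
  (rotInvariants ω i j).starProjection_apply_mem f

lemma rotInvariants_comm (i j : ι) : rotInvariants ω i j = rotInvariants ω j i := by
  have key : ∀ i j : ι, rotInvariants ω i j ≤ rotInvariants ω j i := by
    intro i j f hf
    rw [mem_rotInvariants] at hf ⊢
    intro θ
    rw [← hf (-θ)]
    rw [isoOp_isoOp]
    have : (planeRotationEquiv j i θ).trans (planeRotationEquiv i j (-θ)) =
        (planeRotationEquiv i j (-θ)).trans (planeRotationEquiv i j (-θ)) := by
      ext1 η
      simp [planeRotation_comm i j]
    rw [this, ← isoOp_isoOp, hf, hf]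
  exact le_antisymm (key i j) (key j i)

lemma rotAverage_comm (i j : ι) (f : SphereL2 ι ω) : rotAverage ω i j f = rotAverage ω j i f := by
  have key : ∀ V W : Submodule ℝ (SphereL2 ι ω), V = W → ∀ [V.HasOrthogonalProjection]
      [W.HasOrthogonalProjection], V.starProjection f = W.starProjection f := by
    rintro V _ rfl _ _
    rfl
  exact key _ _ (rotInvariants_comm i j)

lemma rotAverage_self (i : ι) (f : SphereL2 ι ω) : rotAverage ω i i f = f := by
  refine Submodule.starProjection_eq_self_iff.2 (mem_rotInvariants.2 fun θ => ?_)
  have : planeRotationEquiv i i θ = LinearIsometryEquiv.refl ℝ (EuclideanSpace ℝ ι) := by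
    ext1 η; simp
  rw [this]
  exact Lp.compMeasurePreserving_id_apply f

lemma rotAverage_symm (i j : ι) (f g : SphereL2 ι ω) :
    ⟪rotAverage ω i j f, g⟫_ℝ = ⟪f, rotAverage ω i j g⟫_ℝ :=
  Submodule.inner_starProjection_left_eq_right _ _ _

lemma inner_sub_rotAverage (i j : ι) (f : SphereL2 ι ω) :
    ⟪f, f - rotAverage ω i j f⟫_ℝ = ‖f - rotAverage ω i j f‖ ^ 2 :=
  inner_sub_starProjection_self _ f

lemma isoOp_inv_apply (i j : ι) (θ : ℝ) (f : SphereL2 ι ω) :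
    isoOp (planeRotationEquiv i j θ) (isoOp (planeRotationEquiv i j (-θ)) f) = f :=
  isoOp_symm_apply (planeRotationEquiv i j θ) f

/-- Collisions of disjoint pairs give commuting averages. -/
lemma inner_sub_rotAverage_nonneg {i j k l : ι} (hik : i ≠ k) (hil : i ≠ l) (hjk : j ≠ k)
    (hjl : j ≠ l) (f : SphereL2 ι ω) :
    0 ≤ ⟪f - rotAverage ω i j f, f - rotAverage ω k l f⟫_ℝ := by
  refine inner_sub_starProjection_nonneg _ _ (fun x hx => ?_) f
  rw [mem_rotInvariants] at hx ⊢
  -- Rotations in the plane `(k, l)` preserve the `(i, j)`-invariant functions in both directions,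
  -- so they commute with the projection.
  have hcomm : ∀ φ : ℝ, ∀ y ∈ rotInvariants ω i j,
      isoOp (planeRotationEquiv k l φ) y ∈ rotInvariants ω i j := by
    intro φ y hy
    rw [mem_rotInvariants] at hy ⊢
    intro θ
    rw [isoOp_isoOp]
    have : (planeRotationEquiv i j θ).trans (planeRotationEquiv k l φ) =
        (planeRotationEquiv k l φ).trans (planeRotationEquiv i j θ) := by
      ext1 η
      simp [planeRotation_disjoint_comm hik hil hjk hjl]
    rw [this, ← isoOp_isoOp, hy]
  intro φ
  rw [← starProjection_commute_isometry _ _ (isoOp (planeRotationEquiv k l (-φ)))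
    (isoOp_inv_apply k l φ) (hcomm φ) (hcomm (-φ)), hx]

/-- Moving a particle: the distance to the `(x, z)`-invariant functions. -/
lemma norm_sub_rotAverage_triangle (x y z : ι) (f : SphereL2 ι ω) :
    ‖f - rotAverage ω x z f‖ ≤ 2 * ‖f - rotAverage ω x y f‖ + ‖f - rotAverage ω y z f‖ := by
  by_cases hxz : x = z
  · subst hxz; rw [rotAverage_self, sub_self, norm_zero]; positivity
  by_cases hxy : x = y
  · subst hxy
    rw [rotAverage_self, sub_self, norm_zero]; linarith
  by_cases hyz : y = z
  · subst hyz
    rw [rotAverage_self, sub_self, norm_zero]; linarith [norm_nonneg (f - rotAverage ω x y f)]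
  -- The quarter turn takes `(y, z)`-invariant functions to `(x, z)`-invariant ones, so `U (E_yz f)`
  -- competes with the projection `E_xz f`.
  set U := isoOp (ω := ω) (planeRotationEquiv x y (Real.pi / 2)) with hU
  have hmem : U (rotAverage ω y z f) ∈ rotInvariants ω x z := by
    rw [mem_rotInvariants]
    intro θ
    rw [hU, isoOp_isoOp]
    have : (planeRotationEquiv x z θ).trans (planeRotationEquiv x y (Real.pi / 2)) =
        (planeRotationEquiv x y (Real.pi / 2)).trans (planeRotationEquiv y z (-θ)) := by
      ext1 η
      simp [planeRotation_conj hxy hxz hyz]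
    rw [this, ← isoOp_isoOp,
      mem_rotInvariants.1 (rotAverage_mem y z f)]
  have h1 : ‖f - rotAverage ω x z f‖ ≤ ‖f - U (rotAverage ω y z f)‖ :=
    norm_sub_starProjection_le _ f hmem
  have hinv : U (rotAverage ω x y f) = rotAverage ω x y f :=
    mem_rotInvariants.1 (rotAverage_mem x y f) _
  -- As `U` fixes `E_xy f`, replacing `f` by `U f` costs at most `2 ‖f - E_xy f‖`: this is the
  -- factor `2`.
  have h2 : f - U (rotAverage ω y z f) = (f - rotAverage ω x y f) -
      U (f - rotAverage ω x y f) + U (f - rotAverage ω y z f) := by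
    simp only [map_sub, hinv]
    abel
  have h3 : ‖f - U (rotAverage ω y z f)‖ ≤ ‖f - rotAverage ω x y f‖ +
      ‖U (f - rotAverage ω x y f)‖ + ‖U (f - rotAverage ω y z f)‖ := by
    rw [h2]
    exact (norm_add_le _ _).trans (add_le_add (norm_sub_le _ _) le_rfl)
  rw [U.norm_map, U.norm_map] at h3
  linarith

end Operators

/-! ### The uniform angle. -/

section AngleMeasure

/-- The uniform probability measure on the angles `(-π, π]`. -/
def angleMeasure : Measure ℝ :=
  (ENNReal.ofReal (2 * Real.pi))⁻¹ • volume.restrict (Set.Ioc (-Real.pi) Real.pi)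

instance isProbabilityMeasure_angleMeasure : IsProbabilityMeasure angleMeasure := by
  constructor
  have : Real.pi - -Real.pi = 2 * Real.pi := by ring
  rw [angleMeasure, Measure.smul_apply, Measure.restrict_apply_univ, Real.volume_Ioc, smul_eq_mul,
    this]
  refine ENNReal.inv_mul_cancel ?_ ENNReal.ofReal_ne_top
  simp [Real.pi_pos]

lemma integral_angleMeasure (g : ℝ → ℝ) :
    ∫ θ, g θ ∂angleMeasure = 1 / (2 * Real.pi) * ∫ θ in (-Real.pi)..Real.pi, g θ := by
  rw [angleMeasure, integral_smul_measure, intervalIntegral.integral_of_le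
    (by linarith [Real.pi_pos]), ENNReal.toReal_inv, ENNReal.toReal_ofReal (by positivity),
    smul_eq_mul, one_div]

lemma integral_angleMeasure_add {g : ℝ → ℝ} (hg : Function.Periodic g (2 * Real.pi)) (φ : ℝ) :
    ∫ θ, g (θ + φ) ∂angleMeasure = ∫ θ, g θ ∂angleMeasure := by
  rw [integral_angleMeasure, integral_angleMeasure, intervalIntegral.integral_comp_add_right]
  congr 1
  have h1 := hg.intervalIntegral_add_eq (-Real.pi + φ) (-Real.pi)
  rw [show -Real.pi + 2 * Real.pi = Real.pi by ring,
    show -Real.pi + φ + 2 * Real.pi = Real.pi + φ by ring] at h1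
  exact h1

end AngleMeasure

/-! ### The collision integral is the orthogonal projection minus the identity. -/

section Collision

variable {ι : Type} [Fintype ι] [DecidableEq ι]

/-- The pointwise average over the rotations in the `(i, j)` plane. -/
def rotMean (i j : ι) (f : EuclideanSpace ℝ ι → ℝ) (η : EuclideanSpace ℝ ι) : ℝ :=
  ∫ θ, f (planeRotation i j θ η) ∂angleMeasure

lemma rotMean_planeRotation (i j : ι) (f : EuclideanSpace ℝ ι → ℝ) (φ : ℝ)
    (η : EuclideanSpace ℝ ι) : rotMean i j f (planeRotation i j φ η) = rotMean i j f η := by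
  unfold rotMean
  simp only [planeRotation_planeRotation]
  exact integral_angleMeasure_add (g := fun θ => f (planeRotation i j θ η))
    (fun θ => by simp [planeRotation_add_two_pi]) φ

variable {ω : ℝ} [Nonempty ι]

/-- The map `(θ, η) ↦ (θ, R_θ η)` is a skew product preserving the product measure; this supplies
integrability for every use of Fubini with rotations. -/
lemma memLp_comp_planeRotation (i j : ι) {f : EuclideanSpace ℝ ι → ℝ}
    (hf : MemLp f 2 (sphereUniform ι ω)) :
    MemLp (fun p : ℝ × EuclideanSpace ℝ ι => f (planeRotation i j p.1 p.2)) 2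
      (angleMeasure.prod (sphereUniform ι ω)) := by
  have hT : MeasurePreserving
      (fun p : ℝ × EuclideanSpace ℝ ι => (p.1, planeRotation i j p.1 p.2))
      (angleMeasure.prod (sphereUniform ι ω)) (angleMeasure.prod (sphereUniform ι ω)) :=
    MeasurePreserving.skew_product (MeasurePreserving.id angleMeasure)
      (g := fun θ η => planeRotation i j θ η) (continuous_planeRotation i j).measurable
      (Filter.Eventually.of_forall fun θ => (measurePreserving_planeRotation i j θ ω).map_eq)
  exact (hf.comp_snd angleMeasure).comp_measurePreserving hT

lemma memLp_rotMean (i j : ι) {f : EuclideanSpace ℝ ι → ℝ}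
    (hf : MemLp f 2 (sphereUniform ι ω)) : MemLp (rotMean i j f) 2 (sphereUniform ι ω) := by
  have hG := memLp_comp_planeRotation i j hf
  have hG1 := hG.integrable (by norm_num)
  have hG2 := hG.integrable_sq
  have hmeas : AEStronglyMeasurable (rotMean i j f) (sphereUniform ι ω) :=
    hG.aestronglyMeasurable.prod_swap.integral_prod_right'
  rw [memLp_two_iff_integrable_sq hmeas]
  refine Integrable.mono' hG2.integral_prod_right (hmeas.pow 2) ?_
  filter_upwards [hG1.prod_left_ae, hG2.prod_left_ae] with η h1 h2
  rw [Real.norm_eq_abs, abs_of_nonneg (sq_nonneg _)]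
  exact (even_two.convexOn_pow (𝕜 := ℝ)).map_integral_le (continuous_pow 2).continuousOn
    isClosed_univ (by simp) h1 h2

/-- The angular mean is invariant by periodicity. It has the same inner product with an invariant
`w` as `f` does: by Fubini, rotate `f` and `w` together for each fixed angle. -/
lemma rotAverage_toLp (i j : ι) {f : EuclideanSpace ℝ ι → ℝ}
    (hf : MemLp f 2 (sphereUniform ι ω)) :
    rotAverage ω i j hf.toLp = (memLp_rotMean i j hf).toLp := by
  have hM := memLp_rotMean i j hf
  refine Submodule.eq_starProjection_of_mem_of_inner_eq_zero ?_ fun w hw => ?_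
  · rw [mem_rotInvariants]
    intro θ
    rw [isoOp_toLp]
    congr 1
    funext η
    exact rotMean_planeRotation i j f θ η
  · have hG := memLp_comp_planeRotation i j hf
    have hw2 : MemLp w 2 (sphereUniform ι ω) := Lp.memLp w
    rw [inner_sub_left, sub_eq_zero, L2.inner_def, L2.inner_def]
    have e1 : ∫ η, ⟪(hf.toLp : SphereL2 ι ω) η, w η⟫_ℝ ∂(sphereUniform ι ω) =
        ∫ η, f η * w η ∂(sphereUniform ι ω) := by
      refine integral_congr_ae ?_
      filter_upwards [hf.coeFn_toLp] with η h
      rw [h]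
      simp [mul_comm]
    have e2 : ∫ η, ⟪(hM.toLp : SphereL2 ι ω) η, w η⟫_ℝ ∂(sphereUniform ι ω) =
        ∫ η, rotMean i j f η * w η ∂(sphereUniform ι ω) := by
      refine integral_congr_ae ?_
      filter_upwards [hM.coeFn_toLp] with η h
      rw [h]
      simp [mul_comm]
    rw [e1, e2]
    have hint : Integrable (Function.uncurry fun (θ : ℝ) (η : EuclideanSpace ℝ ι) =>
        f (planeRotation i j θ η) * w η) (angleMeasure.prod (sphereUniform ι ω)) :=
      hG.integrable_mul (hw2.comp_snd angleMeasure)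
    have hinner : ∀ θ : ℝ, ∫ η, f (planeRotation i j θ η) * w η ∂(sphereUniform ι ω) =
        ∫ η, f η * w η ∂(sphereUniform ι ω) := by
      intro θ
      have hwθ : w =ᵐ[sphereUniform ι ω] w ∘ planeRotationEquiv i j θ := by
        have := coeFn_isoOp (planeRotationEquiv i j θ) w
        rwa [mem_rotInvariants.1 hw θ] at this
      calc ∫ η, f (planeRotation i j θ η) * w η ∂(sphereUniform ι ω) =
          ∫ η, f (planeRotation i j θ η) * w (planeRotation i j θ η) ∂(sphereUniform ι ω) := by
            refine integral_congr_ae ?_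
            filter_upwards [hwθ] with η h
            rw [h]; rfl
        _ = _ := (measurePreserving_planeRotation i j θ ω).integral_comp
            (planeRotationEquiv i j θ).toHomeomorph.measurableEmbedding (fun η => f η * w η)
    calc ∫ η, f η * w η ∂(sphereUniform ι ω)
        = ∫ _θ, ∫ η, f η * w η ∂(sphereUniform ι ω) ∂angleMeasure := by simp
      _ = ∫ θ, ∫ η, f (planeRotation i j θ η) * w η ∂(sphereUniform ι ω) ∂angleMeasure := by
          simp only [hinner]
      _ = ∫ η, ∫ θ, f (planeRotation i j θ η) * w η ∂angleMeasure ∂(sphereUniform ι ω) :=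
          integral_integral_swap hint
      _ = _ := by
          simp only [integral_mul_const]
          rfl

/-- The collision operator is the defect of the orthogonal projection. -/
lemma collisionOp_ae_eq (i j : ι) {f : EuclideanSpace ℝ ι → ℝ}
    (hf : MemLp f 2 (sphereUniform ι ω)) :
    (fun η => -collisionOp i j f η) =ᵐ[sphereUniform ι ω]
      (hf.toLp - rotAverage ω i j hf.toLp : SphereL2 ι ω) := by
  have hG1 := (memLp_comp_planeRotation i j hf).integrable (by norm_num)
  rw [rotAverage_toLp]
  filter_upwards [Lp.coeFn_sub hf.toLp (memLp_rotMean i j hf).toLp, hf.coeFn_toLp,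
    (memLp_rotMean i j hf).coeFn_toLp, hG1.prod_left_ae] with η h1 h2 h3 h4
  rw [h1, Pi.sub_apply, h2, h3, collisionOp, ← integral_angleMeasure, integral_sub h4
    (integrable_const _)]
  simp [rotMean]

end Collision

/-! ### Continuous functions in `L²` of the sphere. -/

section ContinuousFunctions

variable {ι : Type} [Fintype ι] {ω : ℝ} [Nonempty ι]

lemma memLp_continuousMap (g : C(EuclideanSpace ℝ ι, ℝ)) : MemLp g 2 (sphereUniform ι ω) := by
  obtain ⟨C, hC⟩ := (isCompact_closedBall (0 : EuclideanSpace ℝ ι) √ω).exists_bound_of_continuousOn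
    g.continuous.continuousOn
  refine MemLp.of_bound g.continuous.aestronglyMeasurable C ?_
  filter_upwards [ae_norm_eq (ι := ι) ω] with η h
  exact hC η (by simp [h])

/-- The class in `L²` of a continuous function. -/
def contToL2 (ι : Type) [Fintype ι] [Nonempty ι] (ω : ℝ) :
    C(EuclideanSpace ℝ ι, ℝ) →ₗ[ℝ] SphereL2 ι ω where
  toFun g := (memLp_continuousMap g).toLp
  map_add' f g := MemLp.toLp_add (memLp_continuousMap f) (memLp_continuousMap g)
  map_smul' c f := MemLp.toLp_const_smul c (memLp_continuousMap f)

lemma coeFn_contToL2 (g : C(EuclideanSpace ℝ ι, ℝ)) :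
    contToL2 ι ω g =ᵐ[sphereUniform ι ω] g :=
  (memLp_continuousMap g).coeFn_toLp

lemma inner_contToL2 (f : SphereL2 ι ω) (g : C(EuclideanSpace ℝ ι, ℝ)) :
    ⟪f, contToL2 ι ω g⟫_ℝ = ∫ η, f η * g η ∂(sphereUniform ι ω) := by
  rw [L2.inner_def]
  refine integral_congr_ae ?_
  filter_upwards [coeFn_contToL2 (ω := ω) g] with η h
  rw [h]
  simp [mul_comm]

lemma norm_contToL2_le {g : C(EuclideanSpace ℝ ι, ℝ)} {C : ℝ} (hC : 0 ≤ C)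
    (hg : ∀ η ∈ Metric.closedBall (0 : EuclideanSpace ℝ ι) √ω, ‖g η‖ ≤ C) :
    ‖contToL2 ι ω g‖ ≤ C := by
  have h : ∀ᵐ η ∂(sphereUniform ι ω), ‖contToL2 ι ω g η‖ ≤ C := by
    filter_upwards [coeFn_contToL2 (ω := ω) g, ae_norm_eq (ι := ι) ω] with η h1 h2
    rw [h1]
    exact hg η (by simp [h2])
  refine (Lp.norm_le_of_ae_bound hC h).trans_eq ?_
  have : measureUnivNNReal (sphereUniform ι ω) = 1 := by
    rw [measureUnivNNReal, measure_univ]; rfl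
  simp [this]

/-- A separating algebra of continuous functions is dense in `L²` of the sphere. -/
lemma dense_contToL2_image {S : Subalgebra ℝ C(EuclideanSpace ℝ ι, ℝ)} (hS : S.SeparatesPoints) :
    Dense (contToL2 ι ω '' S) := by
  have hd := BoundedContinuousFunction.toLp_denseRange ℝ (sphereUniform ι ω) (p := 2) ℝ
    (by norm_num)
  refine Dense.of_closure (hd.mono ?_)
  rintro _ ⟨g, rfl⟩
  rw [Metric.mem_closure_iff]
  intro ε hε
  obtain ⟨p, hpS, hp⟩ :=
    ContinuousMap.exists_mem_subalgebra_near_continuous_of_isCompact_of_separatesPoints hS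
      g.toContinuousMap (isCompact_closedBall (0 : EuclideanSpace ℝ ι) √ω) (half_pos hε)
  refine ⟨_, ⟨p, hpS, rfl⟩, ?_⟩
  have hg : BoundedContinuousFunction.toLp 2 (sphereUniform ι ω) ℝ g =
      contToL2 ι ω g.toContinuousMap := rfl
  rw [hg, dist_comm, dist_eq_norm, ← map_sub]
  refine lt_of_le_of_lt (norm_contToL2_le (half_pos hε).le fun η hη => ?_) (half_lt_self hε)
  exact (hp η hη).le

variable [DecidableEq ι]

lemma rotAverage_contToL2 (i j : ι) {g g' : C(EuclideanSpace ℝ ι, ℝ)}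
    (h : ∀ η, rotMean i j g η = g' η) :
    rotAverage ω i j (contToL2 ι ω g) = contToL2 ι ω g' := by
  change rotAverage ω i j (memLp_continuousMap g).toLp = (memLp_continuousMap g').toLp
  rw [rotAverage_toLp]
  congr 1
  funext η
  exact h η

end ContinuousFunctions

/-! ### Rotation-invariant functions are constant. -/

section Ergodicity

variable {ι : Type} [Fintype ι] [DecidableEq ι]

lemma exists_planeRotation_right_eq_zero {i j : ι} (hij : i ≠ j) (η : EuclideanSpace ℝ ι) :
    ∃ θ, planeRotation i j θ η j = 0 ∧ 0 ≤ planeRotation i j θ η i := by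
  -- The angle is the argument of `η i + I η j`.
  set z : ℂ := ⟨η i, η j⟩
  refine ⟨z.arg, ?_, ?_⟩
  · have h1 : ‖z‖ * Real.cos z.arg = η i := Complex.norm_mul_cos_arg z
    have h2 : ‖z‖ * Real.sin z.arg = η j := Complex.norm_mul_sin_arg z
    rw [planeRotation_right hij, ← h1, ← h2]
    ring
  · have h1 : ‖z‖ * Real.cos z.arg = η i := Complex.norm_mul_cos_arg z
    have h2 : ‖z‖ * Real.sin z.arg = η j := Complex.norm_mul_sin_arg z
    rw [planeRotation_left hij, ← h1, ← h2]
    have : Real.cos z.arg * (‖z‖ * Real.cos z.arg) + Real.sin z.arg * (‖z‖ * Real.sin z.arg) =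
        ‖z‖ * (Real.sin z.arg ^ 2 + Real.cos z.arg ^ 2) := by ring
    rw [this, Real.sin_sq_add_cos_sq, mul_one]
    exact norm_nonneg z

/-- Rotations in the planes `(i, j)` clear the coordinates in `S` one by one, leaving earlier zeros
untouched. The sign of `ζ i` is controlled only once some rotation has been made. -/
lemma exists_rotated_of_notMem {h : EuclideanSpace ℝ ι → ℝ}
    (hh : ∀ i j θ η, h (planeRotation i j θ η) = h η) (i : ι) (S : Finset ι) (hi : i ∉ S)
    (η : EuclideanSpace ℝ ι) :
    ∃ ζ, h ζ = h η ∧ ‖ζ‖ = ‖η‖ ∧ (∀ j ∈ S, ζ j = 0) ∧ (S.Nonempty → 0 ≤ ζ i) := by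
  induction S using Finset.induction_on with
  | empty => exact ⟨η, rfl, rfl, by simp, by simp⟩
  | insert j S hj ih =>
    simp only [Finset.mem_insert, not_or] at hi
    obtain ⟨ζ, h1, h2, h3, -⟩ := ih hi.2
    obtain ⟨θ, h4, h5⟩ := exists_planeRotation_right_eq_zero hi.1 ζ
    refine ⟨planeRotation i j θ ζ, by rw [hh, h1], by rw [norm_planeRotation, h2], ?_, fun _ => h5⟩
    intro k hk
    rcases Finset.mem_insert.1 hk with rfl | hk'
    · exact h4
    · rw [planeRotation_of_ne (by rintro rfl; exact hi.2 hk') (by rintro rfl; exact hj hk'), h3 k hk']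

/-- A function invariant under all plane rotations depends on the norm only. -/
lemma eq_of_norm_eq_of_rotation_invariant [Nontrivial ι] {h : EuclideanSpace ℝ ι → ℝ}
    (hh : ∀ i j θ η, h (planeRotation i j θ η) = h η) {η ζ : EuclideanSpace ℝ ι}
    (hn : ‖η‖ = ‖ζ‖) : h η = h ζ := by
  obtain ⟨i, j, hij⟩ := exists_pair_ne ι
  have key : ∀ η : EuclideanSpace ℝ ι, h η = h (EuclideanSpace.single i ‖η‖) := by
    intro η
    obtain ⟨ζ, h1, h2, h3, h4⟩ := exists_rotated_of_notMem hh i (Finset.univ.erase i)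
      (Finset.notMem_erase i _) η
    have hi : 0 ≤ ζ i := h4 ⟨j, by simp [hij.symm]⟩
    have hζ : ζ = EuclideanSpace.single i (ζ i) := by
      ext k
      by_cases hk : k = i
      · subst hk; simp
      · simp [hk, h3 k (by simp [hk])]
    have hn : ‖ζ‖ = ζ i := by
      rw [hζ, PiLp.norm_single, Real.norm_eq_abs, abs_of_nonneg hi]
      simp
    rw [← h1, ← h2, hn, ← hζ]
  rw [key η, key ζ, hn]

/-- The exponential of a linear form. -/
def expForm (b : EuclideanSpace ℝ ι) : C(EuclideanSpace ℝ ι, ℝ) where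
  toFun η := Real.exp ⟪b, η⟫_ℝ
  continuous_toFun := by fun_prop

lemma separatesPoints_adjoin_expForm :
    (Algebra.adjoin ℝ (Set.range (expForm (ι := ι)))).SeparatesPoints := by
  intro x y hxy
  refine ⟨expForm (x - y), ⟨_, Algebra.subset_adjoin ⟨x - y, rfl⟩, rfl⟩, fun h => hxy ?_⟩
  have h1 : ⟪x - y, x⟫_ℝ = ⟪x - y, y⟫_ℝ := Real.exp_injective h
  have h2 : ⟪x - y, x - y⟫_ℝ = 0 := by rw [inner_sub_right, h1, sub_self]
  rw [inner_self_eq_zero] at h2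
  exact sub_eq_zero.1 h2

/-- Exponentials of linear forms are closed under products, so orthogonality to each of them already
gives orthogonality to a dense algebra. -/
lemma adjoin_expForm_eq_span :
    Subalgebra.toSubmodule (Algebra.adjoin ℝ (Set.range (expForm (ι := ι)))) =
      Submodule.span ℝ (Set.range (expForm (ι := ι))) := by
  rw [Algebra.adjoin_eq_span]
  congr 1
  refine subset_antisymm (fun g hg => ?_) Submonoid.subset_closure
  induction hg using Submonoid.closure_induction with
  | mem x hx => exact hx
  | one => exact ⟨0, by ext η; simp [expForm]⟩
  | mul x y _ _ hx hy =>
    obtain ⟨a, rfl⟩ := hx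
    obtain ⟨b, rfl⟩ := hy
    exact ⟨a + b, by ext η; simp [expForm, inner_add_left, Real.exp_add]⟩

variable {ω : ℝ}

lemma inner_expForm_planeRotation [Nonempty ι] {f : SphereL2 ι ω}
    (hf : ∀ i j, f ∈ rotInvariants ω i j) (i j : ι) (θ : ℝ) (b : EuclideanSpace ℝ ι) :
    ⟪f, contToL2 ι ω (expForm (planeRotation i j θ b))⟫_ℝ = ⟪f, contToL2 ι ω (expForm b)⟫_ℝ := by
  rw [inner_contToL2, inner_contToL2]
  have hfθ : f =ᵐ[sphereUniform ι ω] f ∘ planeRotationEquiv i j θ := by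
    have := coeFn_isoOp (planeRotationEquiv i j θ) f
    rwa [mem_rotInvariants.1 (hf i j) θ] at this
  rw [← (measurePreserving_planeRotation i j θ ω).integral_comp
    (planeRotationEquiv i j θ).toHomeomorph.measurableEmbedding]
  refine integral_congr_ae ?_
  filter_upwards [hfθ] with η h
  rw [h]
  have : ⟪planeRotation i j θ b, planeRotation i j θ η⟫_ℝ = ⟪b, η⟫_ℝ :=
    (planeRotationEquiv i j θ).inner_map_map b η
  simp [expForm, this]

/-- The only square-integrable functions on the sphere invariant under all plane rotations are
the constants. -/
lemma eq_zero_of_rotation_invariant [Nontrivial ι] (hω : 0 < ω) {f : SphereL2 ι ω}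
    (hf : ∀ i j, f ∈ rotInvariants ω i j) (hf0 : ∫ η, f η ∂(sphereUniform ι ω) = 0) : f = 0 := by
  set ν := sphereUniform ι ω with hν
  have hsω : 0 < √ω := Real.sqrt_pos.2 hω
  -- The pairing `h b` depends on `‖b‖` only, so `b` may be averaged over a sphere. After Fubini,
  -- `f` is integrated against a rotation-invariant function, which is constant on the sphere, and
  -- `f` has mean zero.
  have hexp : ∀ b, ⟪f, contToL2 ι ω (expForm b)⟫_ℝ = 0 := by
    intro b
    set t := ‖b‖ / √ω with ht
    have ht0 : 0 ≤ t := by positivity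
    set h : EuclideanSpace ℝ ι → ℝ := fun b => ⟪f, contToL2 ι ω (expForm b)⟫_ℝ with hh
    have hconst : ∀ᵐ a ∂ν, h (t • a) = h b := by
      filter_upwards [ae_norm_eq (ι := ι) ω] with a ha
      refine eq_of_norm_eq_of_rotation_invariant (h := h)
        (fun i j θ η => inner_expForm_planeRotation hf i j θ η) ?_
      rw [norm_smul, ha, Real.norm_eq_abs, abs_of_nonneg ht0, ht]
      field_simp
    set c : EuclideanSpace ℝ ι → ℝ := fun η => ∫ a, Real.exp ⟪t • a, η⟫_ℝ ∂ν with hc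
    have hcinv : ∀ i j θ η, c (planeRotation i j θ η) = c η := by
      intro i j θ η
      simp only [hc]
      rw [← (measurePreserving_planeRotation i j θ ω).integral_comp
        (planeRotationEquiv i j θ).toHomeomorph.measurableEmbedding]
      refine integral_congr_ae (Filter.Eventually.of_forall fun a => ?_)
      have : ⟪planeRotation i j θ a, planeRotation i j θ η⟫_ℝ = ⟪a, η⟫_ℝ :=
        (planeRotationEquiv i j θ).inner_map_map a η
      simp only [real_inner_smul_left, this]
    obtain ⟨i⟩ : Nonempty ι := inferInstance
    set c₀ := c (EuclideanSpace.single i √ω)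
    have hc0 : ∀ᵐ η ∂ν, c η = c₀ := by
      filter_upwards [ae_norm_eq (ι := ι) ω] with η hη
      refine eq_of_norm_eq_of_rotation_invariant hcinv ?_
      rw [hη, PiLp.norm_single, Real.norm_eq_abs, abs_of_pos hsω]
    have hint : Integrable (Function.uncurry fun (a η : EuclideanSpace ℝ ι) =>
        f η * Real.exp ⟪t • a, η⟫_ℝ) (ν.prod ν) := by
      have hf1 : MemLp (fun p : EuclideanSpace ℝ ι × EuclideanSpace ℝ ι => f p.2) 2 (ν.prod ν) :=
        (Lp.memLp f).comp_snd ν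
      have hf2 : MemLp (fun p : EuclideanSpace ℝ ι × EuclideanSpace ℝ ι =>
          Real.exp ⟪t • p.1, p.2⟫_ℝ) 2 (ν.prod ν) := by
        refine MemLp.of_bound (Continuous.aestronglyMeasurable (by fun_prop))
          (Real.exp (t * √ω * √ω)) ?_
        have h1 : ∀ᵐ p ∂(ν.prod ν), ‖p.1‖ = √ω :=
          Measure.quasiMeasurePreserving_fst.ae (ae_norm_eq (ι := ι) ω)
        have h2 : ∀ᵐ p ∂(ν.prod ν), ‖p.2‖ = √ω :=
          Measure.quasiMeasurePreserving_snd.ae (ae_norm_eq (ι := ι) ω)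
        filter_upwards [h1, h2] with p h1 h2
        rw [Real.norm_eq_abs, Real.abs_exp, Real.exp_le_exp]
        refine (real_inner_le_norm _ _).trans_eq ?_
        rw [norm_smul, h1, h2, Real.norm_eq_abs, abs_of_nonneg ht0]
      exact hf1.integrable_mul hf2
    calc h b = ∫ _a, h b ∂ν := by simp
      _ = ∫ a, h (t • a) ∂ν := (integral_congr_ae hconst).symm
      _ = ∫ a, ∫ η, f η * Real.exp ⟪t • a, η⟫_ℝ ∂ν ∂ν := by
          simp only [hh, inner_contToL2]
          rfl
      _ = ∫ η, ∫ a, f η * Real.exp ⟪t • a, η⟫_ℝ ∂ν ∂ν := integral_integral_swap hint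
      _ = ∫ η, f η * c η ∂ν := by simp only [integral_const_mul, hc]
      _ = ∫ η, f η * c₀ ∂ν := by
          refine integral_congr_ae ?_
          filter_upwards [hc0] with η h
          rw [h]
      _ = 0 := by rw [integral_mul_const, hf0, zero_mul]
  have hspan : ∀ g ∈ Submodule.span ℝ (Set.range (expForm (ι := ι))),
      ⟪f, contToL2 ι ω g⟫_ℝ = 0 := by
    intro g hg
    induction hg using Submodule.span_induction with
    | mem x hx => obtain ⟨b, rfl⟩ := hx; exact hexp b
    | zero => simp
    | add x y _ _ hx hy => rw [map_add, inner_add_right, hx, hy, add_zero]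
    | smul a x _ hx => rw [map_smul, real_inner_smul_right, hx, mul_zero]
  have hcl : IsClosed {g : SphereL2 ι ω | ⟪f, g⟫_ℝ = 0} :=
    isClosed_eq (by fun_prop) continuous_const
  have hsub : contToL2 ι ω '' (Algebra.adjoin ℝ (Set.range (expForm (ι := ι)))) ⊆
      {g : SphereL2 ι ω | ⟪f, g⟫_ℝ = 0} := by
    rintro _ ⟨g, hg, rfl⟩
    refine hspan g ?_
    rw [← adjoin_expForm_eq_span]
    exact hg
  have hall : f ∈ {g : SphereL2 ι ω | ⟪f, g⟫_ℝ = 0} :=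
    closure_minimal hsub hcl (dense_contToL2_image separatesPoints_adjoin_expForm f)
  exact inner_self_eq_zero.1 hall

end Ergodicity

/-! ### Moments of the circle and the eigenvalue bounds. -/

section CircleMoments

/-- The moments of a uniform point of the unit circle. -/
def circleMoment (p r : ℕ) : ℝ := ∫ θ, Real.cos θ ^ p * (-Real.sin θ) ^ r ∂angleMeasure

/-- In polar coordinates the point `(x, y)` only shifts the angle, which the uniform measure does
not see. -/
lemma integral_rotated_monomial (p r : ℕ) (x y : ℝ) :
    ∫ θ, (Real.cos θ * x + Real.sin θ * y) ^ p * (-Real.sin θ * x + Real.cos θ * y) ^ r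
      ∂angleMeasure = circleMoment p r * √(x ^ 2 + y ^ 2) ^ (p + r) := by
  set z : ℂ := ⟨x, y⟩ with hz
  have h1 : ‖z‖ * Real.cos z.arg = x := Complex.norm_mul_cos_arg z
  have h2 : ‖z‖ * Real.sin z.arg = y := Complex.norm_mul_sin_arg z
  have h3 : ‖z‖ = √(x ^ 2 + y ^ 2) := by
    rw [Complex.norm_def, Complex.normSq_apply, hz]
    simp only [sq]
  have h4 := integral_angleMeasure_add
    (g := fun θ => Real.cos θ ^ p * (-Real.sin θ) ^ r) (fun θ => by simp) (-z.arg)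
  rw [circleMoment, ← h4, ← h3, ← integral_mul_const]
  congr 1
  funext θ
  rw [← h1, ← h2, Real.cos_add, Real.sin_add, Real.cos_neg, Real.sin_neg, pow_add]
  rw [show Real.cos θ * (‖z‖ * Real.cos z.arg) + Real.sin θ * (‖z‖ * Real.sin z.arg) =
    (Real.cos θ * Real.cos z.arg - Real.sin θ * -Real.sin z.arg) * ‖z‖ by ring,
    show -Real.sin θ * (‖z‖ * Real.cos z.arg) + Real.cos θ * (‖z‖ * Real.sin z.arg) =
    (-(Real.sin θ * Real.cos z.arg + Real.cos θ * -Real.sin z.arg)) * ‖z‖ by ring, mul_pow, mul_pow]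
  ring

lemma circleMoment_eq_zero_of_odd {p r : ℕ} (h : Odd (p + r)) : circleMoment p r = 0 := by
  have h4 := integral_angleMeasure_add
    (g := fun θ => Real.cos θ ^ p * (-Real.sin θ) ^ r) (fun θ => by simp) Real.pi
  have h5 : ∀ θ : ℝ, Real.cos (θ + Real.pi) ^ p * (-Real.sin (θ + Real.pi)) ^ r =
      -(Real.cos θ ^ p * (-Real.sin θ) ^ r) := by
    intro θ
    rw [Real.cos_add_pi, Real.sin_add_pi, neg_pow, neg_pow (-Real.sin θ)]
    have : (-1 : ℝ) ^ p * (-1) ^ r = -1 := by rw [← pow_add, h.neg_one_pow]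
    linear_combination (Real.cos θ ^ p * (-Real.sin θ) ^ r) * this
  simp only [h5, integral_neg] at h4
  unfold circleMoment
  linarith

lemma integral_rotated_monomial_even {p r l : ℕ} (h : p + r = 2 * l) (x y : ℝ) :
    ∫ θ, (Real.cos θ * x + Real.sin θ * y) ^ p * (-Real.sin θ * x + Real.cos θ * y) ^ r
      ∂angleMeasure = circleMoment p r * (x ^ 2 + y ^ 2) ^ l := by
  rw [integral_rotated_monomial, h, pow_mul, Real.sq_sqrt (by positivity)]

lemma circleMoment_two : circleMoment 2 0 = 1 / 2 := by
  have := Real.pi_pos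
  rw [circleMoment, integral_angleMeasure]
  simp only [pow_zero, mul_one]
  rw [integral_cos_sq]
  simp
  field_simp

lemma circleMoment_four : circleMoment 4 0 = 3 / 8 := by
  have := Real.pi_pos
  rw [circleMoment, integral_angleMeasure]
  simp only [pow_zero, mul_one]
  rw [integral_cos_pow (n := 2), integral_cos_sq]
  simp
  field_simp
  ring

lemma circleMoment_nonneg {m : ℕ} (hm : Even m) : 0 ≤ circleMoment m 0 :=
  integral_nonneg fun θ => by simpa using hm.pow_nonneg (Real.cos θ)

lemma circleMoment_le {m : ℕ} (hm : Even m) (h4 : 4 ≤ m) : circleMoment m 0 ≤ 3 / 8 := by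
  rw [← circleMoment_four, circleMoment, circleMoment, integral_angleMeasure,
    integral_angleMeasure]
  refine mul_le_mul_of_nonneg_left ?_ (by positivity)
  refine intervalIntegral.integral_mono_on (by linarith [Real.pi_pos])
    (Continuous.intervalIntegrable (by fun_prop) _ _)
    (Continuous.intervalIntegrable (by fun_prop) _ _) fun θ _ => ?_
  simp only [pow_zero, mul_one]
  rw [← hm.pow_abs, ← (show Even 4 by decide).pow_abs (Real.cos θ)]
  exact pow_le_pow_of_le_one (abs_nonneg _) (Real.abs_cos_le_one θ) h4

/-- The eigenvalue of the three-particle correlation operator in degree `m`. -/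
def collisionEigenvalue (m : ℕ) : ℝ := (-1) ^ (m / 2) * circleMoment m 0

/-- The value is `0` for odd `m`, `-1/2` for `m = 2`, and at most `3/8` in modulus for even `m ≥ 4`.
The constant `7/4` is attained by `1 + 2κ` at `m = 4`. -/
lemma collisionEigenvalue_bounds {m : ℕ} (hm : 1 ≤ m) :
    1 - collisionEigenvalue m ≤ 7 / 4 ∧ 1 + 2 * collisionEigenvalue m ≤ 7 / 4 := by
  rcases Nat.even_or_odd m with he | ho
  · rcases eq_or_ne m 2 with rfl | h2
    · rw [collisionEigenvalue, circleMoment_two]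
      norm_num
    · have h4 : 4 ≤ m := by
        obtain ⟨k, rfl⟩ := he
        omega
      have h0 := circleMoment_nonneg he
      have h1 := circleMoment_le he h4
      rw [collisionEigenvalue]
      rcases neg_one_pow_eq_or ℝ (m / 2) with h | h <;> rw [h] <;> constructor <;> linarith
  · rw [collisionEigenvalue, circleMoment_eq_zero_of_odd (by simpa using ho)]
    norm_num

end CircleMoments

/-! ### Functions of one coordinate of a triple, with invariant coefficients. -/

section ThreeParticles

variable {ι : Type} [Fintype ι] [DecidableEq ι]

/-- The algebra of continuous functions invariant under the rotations of the coordinates in `T`. -/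
def blockInvariants (T : Finset ι) : Subalgebra ℝ C(EuclideanSpace ℝ ι, ℝ) where
  carrier := {q | ∀ a ∈ T, ∀ b ∈ T, ∀ θ η, q (planeRotation a b θ η) = q η}
  mul_mem' hp hq a ha b hb θ η := by
    simp only [ContinuousMap.mul_apply, hp a ha b hb, hq a ha b hb]
  add_mem' hp hq a ha b hb θ η := by
    simp only [ContinuousMap.add_apply, hp a ha b hb, hq a ha b hb]
  algebraMap_mem' c a ha b hb θ η := by simp

/-- The coordinate functions. -/
def coordMap (a : ι) : C(EuclideanSpace ℝ ι, ℝ) where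
  toFun η := η a
  continuous_toFun := by fun_prop

lemma coordMap_mem_blockInvariants {T : Finset ι} {a : ι} (ha : a ∉ T) :
    coordMap a ∈ blockInvariants T := by
  intro b hb c hc θ η
  exact planeRotation_of_ne (by rintro rfl; exact ha hb) (by rintro rfl; exact ha hc) θ η

/-- The energy of the coordinates in `T`. -/
def blockEnergy (T : Finset ι) : C(EuclideanSpace ℝ ι, ℝ) := ∑ a ∈ T, coordMap a ^ 2

lemma blockEnergy_mem (T : Finset ι) : blockEnergy T ∈ blockInvariants T := by
  intro b hb c hc θ η
  have key : ∀ η, blockEnergy T η = ‖η‖ ^ 2 - ∑ a ∈ Tᶜ, η a ^ 2 := by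
    intro η
    rw [EuclideanSpace.norm_sq_eq, ← Finset.sum_add_sum_compl T]
    simp [blockEnergy, coordMap, ContinuousMap.sum_apply]
  rw [key, key, norm_planeRotation]
  congr 1
  refine Finset.sum_congr rfl fun a ha => ?_
  have := coordMap_mem_blockInvariants (Finset.mem_compl.1 ha) b hb c hc θ η
  simp only [coordMap, ContinuousMap.coe_mk] at this
  rw [this]

/-- The span of the functions `η a ^ l * q` with `a ∈ T`, `l ≤ m` and `q` invariant. -/
def blockFiltration (T : Finset ι) (m : ℕ) : Submodule ℝ C(EuclideanSpace ℝ ι, ℝ) :=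
  Submodule.span ℝ {g | ∃ a ∈ T, ∃ l ≤ m, ∃ q ∈ blockInvariants T, g = coordMap a ^ l * q}

lemma mem_blockFiltration {T : Finset ι} {m : ℕ} {a : ι} (ha : a ∈ T) {l : ℕ} (hl : l ≤ m)
    {q : C(EuclideanSpace ℝ ι, ℝ)} (hq : q ∈ blockInvariants T) :
    coordMap a ^ l * q ∈ blockFiltration T m :=
  Submodule.subset_span ⟨a, ha, l, hl, q, hq, rfl⟩

lemma blockFiltration_mono (T : Finset ι) {m n : ℕ} (h : m ≤ n) :
    blockFiltration T m ≤ blockFiltration T n := by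
  refine Submodule.span_mono ?_
  rintro g ⟨a, ha, l, hl, q, hq, rfl⟩
  exact ⟨a, ha, l, hl.trans h, q, hq, rfl⟩

/-- In the binomial expansion every term but the top one carries a power of the block energy, which
is invariant and joins the coefficient `q`; the degree in `c` then drops by at least two. -/
lemma lower_order_mem {T : Finset ι} {c : ι} (hc : c ∈ T) {q : C(EuclideanSpace ℝ ι, ℝ)}
    (hq : q ∈ blockInvariants T) {t l m : ℕ} (h : t + 2 * l ≤ m + 1) :
    coordMap c ^ t * (blockEnergy T - coordMap c ^ 2) ^ l * q -
      ((-1 : ℝ) ^ l) • (coordMap c ^ (t + 2 * l) * q) ∈ blockFiltration T m := by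
  rw [sub_eq_neg_add (blockEnergy T), add_pow, Finset.sum_range_succ]
  have e : coordMap c ^ t * (∑ x ∈ Finset.range l, (-coordMap c ^ 2) ^ x *
      blockEnergy T ^ (l - x) * (l.choose x : C(EuclideanSpace ℝ ι, ℝ)) +
      (-coordMap c ^ 2) ^ l * blockEnergy T ^ (l - l) *
      (l.choose l : C(EuclideanSpace ℝ ι, ℝ))) * q -
      ((-1 : ℝ) ^ l) • (coordMap c ^ (t + 2 * l) * q) =
      ∑ x ∈ Finset.range l, coordMap c ^ (t + 2 * x) *
        ((-1) ^ x * blockEnergy T ^ (l - x) * (l.choose x : C(EuclideanSpace ℝ ι, ℝ)) * q) := by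
    have h1 : ((-1 : ℝ) ^ l) • (coordMap c ^ (t + 2 * l) * q) =
        (-1) ^ l * (coordMap c ^ (t + 2 * l) * q) := by
      rw [Algebra.smul_def]; simp
    have h2 : coordMap c ^ t * ((-coordMap c ^ 2) ^ l * blockEnergy T ^ (l - l) *
      (l.choose l : C(EuclideanSpace ℝ ι, ℝ))) * q = (-1) ^ l * (coordMap c ^ (t + 2 * l) * q) := by
      rw [Nat.sub_self, Nat.choose_self, neg_pow, ← pow_mul, pow_add]
      simp only [pow_zero, Nat.cast_one, mul_one]
      ring
    rw [h1, mul_add, add_mul, h2, add_sub_cancel_right, Finset.mul_sum, Finset.sum_mul]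
    refine Finset.sum_congr rfl fun x _ => ?_
    rw [neg_pow, ← pow_mul, pow_add]
    ring
  rw [e]
  refine Submodule.sum_mem _ fun x hx => mem_blockFiltration hc ?_ ?_
  · have := Finset.mem_range.1 hx
    omega
  · refine mul_mem (mul_mem (mul_mem ?_ ?_) ?_) hq
    · exact pow_mem (neg_mem (one_mem _)) _
    · exact pow_mem (blockEnergy_mem T) _
    · exact natCast_mem _ _

lemma lower_order_mem' {T : Finset ι} {c : ι} (hc : c ∈ T) {q : C(EuclideanSpace ℝ ι, ℝ)}
    (hq : q ∈ blockInvariants T) (t l : ℕ) :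
    coordMap c ^ t * (blockEnergy T - coordMap c ^ 2) ^ l * q ∈
      blockFiltration T (t + 2 * l) := by
  have h := lower_order_mem hc hq (t := t) (l := l) (m := t + 2 * l) (by omega)
  have h2 := Submodule.smul_mem _ ((-1 : ℝ) ^ l) (mem_blockFiltration hc le_rfl hq :
    coordMap c ^ (t + 2 * l) * q ∈ blockFiltration T (t + 2 * l))
  simpa using Submodule.add_mem _ h h2

lemma blockEnergy_sub {a b c : ι} (hab : a ≠ b) (hac : a ≠ c) (hbc : b ≠ c) {T : Finset ι}
    (hT : T = {a, b, c}) : blockEnergy T - coordMap c ^ 2 = coordMap a ^ 2 + coordMap b ^ 2 := by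
  subst hT
  rw [blockEnergy, Finset.sum_insert (by simp [hab, hac]), Finset.sum_insert (by simp [hbc]),
    Finset.sum_singleton]
  ring

/-- The average depends on `(a, b)` through `a² + b²`, which is the block energy minus `c²`. Thus
averaging over one pair always produces a function of the third coordinate alone, up to invariant
coefficients. -/
lemma rotMean_monomial {a b c : ι} (hab : a ≠ b) (hac : a ≠ c) (hbc : b ≠ c) {T : Finset ι}
    (hT : T = {a, b, c}) {q : C(EuclideanSpace ℝ ι, ℝ)} (hq : q ∈ blockInvariants T)
    {p r t l : ℕ} (h : p + r = 2 * l) (η : EuclideanSpace ℝ ι) :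
    rotMean a b (coordMap a ^ p * coordMap b ^ r * coordMap c ^ t * q) η =
      (circleMoment p r • (coordMap c ^ t * (blockEnergy T - coordMap c ^ 2) ^ l * q)) η := by
  have hq' : ∀ θ, q (planeRotation a b θ η) = q η := fun θ =>
    hq a (by simp [hT]) b (by simp [hT]) θ η
  have h1 := integral_rotated_monomial_even h (η a) (η b)
  rw [blockEnergy_sub hab hac hbc hT]
  simp only [rotMean, coordMap, ContinuousMap.mul_apply, ContinuousMap.pow_apply,
    ContinuousMap.coe_mk, hq', planeRotation_left hab, planeRotation_right hab,
    planeRotation_of_ne hac.symm hbc.symm, integral_mul_const, h1, ContinuousMap.smul_apply,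
    ContinuousMap.add_apply, smul_eq_mul, Pi.mul_apply, Pi.pow_apply]
  ring

lemma rotMean_monomial_odd {a b c : ι} (hab : a ≠ b) (hac : a ≠ c) (hbc : b ≠ c) {T : Finset ι}
    (hT : T = {a, b, c}) {q : C(EuclideanSpace ℝ ι, ℝ)} (hq : q ∈ blockInvariants T)
    {p r t : ℕ} (h : Odd (p + r)) (η : EuclideanSpace ℝ ι) :
    rotMean a b (coordMap a ^ p * coordMap b ^ r * coordMap c ^ t * q) η =
      (0 : C(EuclideanSpace ℝ ι, ℝ)) η := by
  have hq' : ∀ θ, q (planeRotation a b θ η) = q η := fun θ =>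
    hq a (by simp [hT]) b (by simp [hT]) θ η
  have h1 := integral_rotated_monomial p r (η a) (η b)
  rw [circleMoment_eq_zero_of_odd h, zero_mul] at h1
  simp only [rotMean, coordMap,
    ContinuousMap.coe_mk, hq', planeRotation_left hab, planeRotation_right hab,
    planeRotation_of_ne hac.symm hbc.symm, integral_mul_const, h1,
    Pi.mul_apply, Pi.pow_apply, zero_mul,
    ContinuousMap.zero_apply]

end ThreeParticles

/-! ### The three-particle gap. -/

section ThreeParticleGap

/-- Modulo `F`, `A` acts on `x, y, z` as `(1 - κ) I + κ J` with `J` the all-ones matrix, whose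
eigenvalues are `1 - κ` and `1 + 2κ`; this is the resulting quadratic relation. -/
lemma quadratic_mem {M : Type*} [AddCommGroup M] [Module ℝ M] {A : M →ₗ[ℝ] M} {F : Submodule ℝ M}
    (hA : ∀ x ∈ F, A x ∈ F) {κ : ℝ} {x y z : M} (hx : A x - (x + κ • y + κ • z) ∈ F)
    (hy : A y - (y + κ • x + κ • z) ∈ F) (hz : A z - (z + κ • x + κ • y) ∈ F) :
    A (A x) - ((1 - κ) + (1 + 2 * κ)) • A x + ((1 - κ) * (1 + 2 * κ)) • x ∈ F := by
  have h := F.add_mem (F.add_mem (F.add_mem (hA _ hx) (F.smul_mem κ hy)) (F.smul_mem κ hz))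
    (F.smul_mem (-(1 + κ)) hx)
  convert! h using 1
  simp only [map_sub, map_add, map_smul]
  module

variable {ι : Type} [Fintype ι] [DecidableEq ι] [Nonempty ι] {ω : ℝ}

lemma rotAverage_monomial_mem {a b c : ι} (hab : a ≠ b) (hac : a ≠ c) (hbc : b ≠ c) {T : Finset ι}
    (hT : T = {a, b, c}) {q : C(EuclideanSpace ℝ ι, ℝ)} (hq : q ∈ blockInvariants T)
    (p r t : ℕ) : rotAverage ω a b (contToL2 ι ω (coordMap a ^ p * coordMap b ^ r *
      coordMap c ^ t * q)) ∈ (blockFiltration T (t + (p + r))).map (contToL2 ι ω) := by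
  rcases Nat.even_or_odd' (p + r) with ⟨l, h | h⟩
  · rw [rotAverage_contToL2 a b (rotMean_monomial hab hac hbc hT hq h), h]
    exact Submodule.mem_map_of_mem
      (Submodule.smul_mem _ _ (lower_order_mem' (by simp [hT]) hq t l))
  · rw [rotAverage_contToL2 a b (rotMean_monomial_odd hab hac hbc hT hq ⟨l, h⟩), map_zero]
    exact Submodule.zero_mem _

lemma rotAverage_of_third {a b c : ι} (hac : a ≠ c) (hbc : b ≠ c) {T : Finset ι}
    (hT : T = {a, b, c}) {q : C(EuclideanSpace ℝ ι, ℝ)} (hq : q ∈ blockInvariants T) (m : ℕ) :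
    rotAverage ω a b (contToL2 ι ω (coordMap c ^ m * q)) = contToL2 ι ω (coordMap c ^ m * q) := by
  refine rotAverage_contToL2 a b fun η => ?_
  have hq' : ∀ θ, q (planeRotation a b θ η) = q η := fun θ =>
    hq a (by simp [hT]) b (by simp [hT]) θ η
  simp [rotMean, coordMap, hq', planeRotation_of_ne hac.symm hbc.symm]

lemma rotAverage_of_first {a b c : ι} (hab : a ≠ b) (hac : a ≠ c) (hbc : b ≠ c) {T : Finset ι}
    (hT : T = {a, b, c}) {q : C(EuclideanSpace ℝ ι, ℝ)} (hq : q ∈ blockInvariants T) (m : ℕ) :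
    rotAverage ω a b (contToL2 ι ω (coordMap a ^ (m + 1) * q)) -
      collisionEigenvalue (m + 1) • contToL2 ι ω (coordMap c ^ (m + 1) * q) ∈
      (blockFiltration T m).map (contToL2 ι ω) := by
  have e : coordMap a ^ (m + 1) * q =
      coordMap a ^ (m + 1) * coordMap b ^ 0 * coordMap c ^ 0 * q := by simp
  have hc : c ∈ T := by simp [hT]
  rcases Nat.even_or_odd' (m + 1) with ⟨l, h | h⟩
  · rw [e, rotAverage_contToL2 a b (rotMean_monomial hab hac hbc hT hq (l := l) (by omega)),
      ← map_smul, ← map_sub]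
    refine Submodule.mem_map_of_mem ?_
    have h1 := lower_order_mem hc hq (t := 0) (l := l) (m := m) (by omega)
    have h2 := Submodule.smul_mem _ (circleMoment (m + 1) 0) h1
    rw [smul_sub, smul_smul] at h2
    convert! h2 using 3
    · rw [collisionEigenvalue, mul_comm, h, Nat.mul_div_cancel_left _ (by norm_num)]
    · rw [h, zero_add]
  · have h0 : collisionEigenvalue (m + 1) = 0 := by
      rw [collisionEigenvalue, circleMoment_eq_zero_of_odd (by exact ⟨l, h⟩), mul_zero]
    rw [e, rotAverage_contToL2 a b (rotMean_monomial_odd hab hac hbc hT hq (p := m + 1) (r := 0)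
      ⟨l, h⟩), h0, zero_smul,
      map_zero, sub_zero]
    exact Submodule.zero_mem _

/-- The sum of the averages over the three pairs of a triple. -/
def tripleSum (ω : ℝ) (i j k : ι) : SphereL2 ι ω →L[ℝ] SphereL2 ι ω :=
  rotAverage ω i j + rotAverage ω j k + rotAverage ω i k

lemma tripleSum_apply (i j k : ι) (f : SphereL2 ι ω) :
    tripleSum ω i j k f = rotAverage ω i j f + rotAverage ω j k f + rotAverage ω i k f := rfl

lemma tripleSum_symm (i j k : ι) (f g : SphereL2 ι ω) :
    ⟪tripleSum ω i j k f, g⟫_ℝ = ⟪f, tripleSum ω i j k g⟫_ℝ := by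
  simp only [tripleSum_apply, inner_add_left, inner_add_right, rotAverage_symm]

lemma tripleSum_rotate (i j k : ι) : tripleSum ω i j k = tripleSum ω j k i := by
  ext1 f
  rw [tripleSum_apply, tripleSum_apply, rotAverage_comm k i, rotAverage_comm j i]
  abel

/-- The pair `(j, k)` fixes the power of `i`. The pair `(i, j)` turns it into `κ` times the power of
`k`, and `(i, k)` into `κ` times that of `j`, both up to lower degree. -/
lemma tripleSum_leading {i j k : ι} (hij : i ≠ j) (hik : i ≠ k) (hjk : j ≠ k) {T : Finset ι}
    (hT : T = {i, j, k}) {q : C(EuclideanSpace ℝ ι, ℝ)} (hq : q ∈ blockInvariants T) (m : ℕ) :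
    tripleSum ω i j k (contToL2 ι ω (coordMap i ^ (m + 1) * q)) -
      (contToL2 ι ω (coordMap i ^ (m + 1) * q) +
        collisionEigenvalue (m + 1) • contToL2 ι ω (coordMap j ^ (m + 1) * q) +
        collisionEigenvalue (m + 1) • contToL2 ι ω (coordMap k ^ (m + 1) * q)) ∈
      (blockFiltration T m).map (contToL2 ι ω) := by
  have h1 := rotAverage_of_third (ω := ω) hij.symm hik.symm (T := T)
    (by rw [hT]; ext x; simp; tauto) hq (m + 1) (a := j) (b := k) (c := i)
  have h2 := rotAverage_of_first (ω := ω) hij hik hjk hT hq m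
  have h3 := rotAverage_of_first (ω := ω) hik hij hjk.symm (T := T)
    (by rw [hT]; ext x; simp; tauto) hq m
  rw [tripleSum_apply, h1]
  convert! Submodule.add_mem _ h2 h3 using 1
  abel

lemma tripleSum_mem {i j k : ι} (hij : i ≠ j) (hik : i ≠ k) (hjk : j ≠ k) {T : Finset ι}
    (hT : T = {i, j, k}) (m : ℕ) : ∀ x ∈ (blockFiltration T m).map (contToL2 ι ω),
      tripleSum ω i j k x ∈ (blockFiltration T m).map (contToL2 ι ω) := by
  have hgen : ∀ {i j k : ι}, i ≠ j → i ≠ k → j ≠ k → T = {i, j, k} → ∀ l ≤ m,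
      ∀ q ∈ blockInvariants T, tripleSum ω i j k (contToL2 ι ω (coordMap i ^ l * q)) ∈
        (blockFiltration T m).map (contToL2 ι ω) := by
    intro i j k hij hik hjk hT l hl q hq
    have hmem : ∀ a ∈ T, contToL2 ι ω (coordMap a ^ l * q) ∈
        (blockFiltration T m).map (contToL2 ι ω) := fun a ha =>
      Submodule.mem_map_of_mem (mem_blockFiltration ha hl hq)
    have hi := hmem i (by simp [hT])
    have hj := hmem j (by simp [hT])
    have hk := hmem k (by simp [hT])
    cases l with
    | zero =>
      have e1 := rotAverage_of_third (ω := ω) hij.symm hik.symm (T := T)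
        (by rw [hT]; ext x; simp; tauto) hq 0 (a := j) (b := k) (c := i)
      have e2 := rotAverage_of_third (ω := ω) hik hjk (T := T) hT hq 0
      have e3 := rotAverage_of_third (ω := ω) hij hjk.symm (T := T)
        (by rw [hT]; ext x; simp; tauto) hq 0 (a := i) (b := k) (c := j)
      simp only [pow_zero] at e1 e2 e3 hi ⊢
      rw [tripleSum_apply, e1, e2, e3]
      exact Submodule.add_mem _ (Submodule.add_mem _ hi hi) hi
    | succ l =>
      have h := tripleSum_leading (ω := ω) hij hik hjk hT hq l
      have h' := Submodule.map_mono (f := contToL2 ι ω)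
        (blockFiltration_mono T ((Nat.le_succ l).trans hl)) h
      have := Submodule.add_mem _ h' (Submodule.add_mem _ (Submodule.add_mem _ hi
        (Submodule.smul_mem _ (collisionEigenvalue (l + 1)) hj))
        (Submodule.smul_mem _ (collisionEigenvalue (l + 1)) hk))
      simpa using this
  rintro _ ⟨g, hg, rfl⟩
  induction hg using Submodule.span_induction with
  | mem x hx =>
    obtain ⟨a, ha, l, hl, q, hq, rfl⟩ := hx
    rw [hT] at ha
    simp only [Finset.mem_insert, Finset.mem_singleton] at ha
    rcases ha with rfl | rfl | rfl
    · exact hgen hij hik hjk hT l hl q hq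
    · rw [tripleSum_rotate]
      exact hgen hjk hij.symm hik.symm (by rw [hT]; ext x; simp; tauto) l hl q hq
    · rw [tripleSum_rotate, tripleSum_rotate]
      exact hgen hik.symm hjk.symm hij (by rw [hT]; ext x; simp; tauto) l hl q hq
  | zero => simp
  | add x y _ _ hx hy => rw [map_add, map_add]; exact Submodule.add_mem _ hx hy
  | smul c x _ hx => rw [map_smul, map_smul]; exact Submodule.smul_mem _ _ hx

lemma tripleSum_quadratic_mem {i j k : ι} (hij : i ≠ j) (hik : i ≠ k) (hjk : j ≠ k) {T : Finset ι}
    (hT : T = {i, j, k}) (m : ℕ) : ∀ x ∈ (blockFiltration T (m + 1)).map (contToL2 ι ω),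
      tripleSum ω i j k (tripleSum ω i j k x) -
        ((1 - collisionEigenvalue (m + 1)) + (1 + 2 * collisionEigenvalue (m + 1))) •
          tripleSum ω i j k x +
        ((1 - collisionEigenvalue (m + 1)) * (1 + 2 * collisionEigenvalue (m + 1))) • x ∈
      (blockFiltration T m).map (contToL2 ι ω) := by
  have hA := tripleSum_mem (ω := ω) hij hik hjk hT m
  have hgen : ∀ {i j k : ι}, i ≠ j → i ≠ k → j ≠ k → T = {i, j, k} →
      (∀ x ∈ (blockFiltration T m).map (contToL2 ι ω),
        tripleSum ω i j k x ∈ (blockFiltration T m).map (contToL2 ι ω)) →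
      ∀ q ∈ blockInvariants T, ∀ x, x = contToL2 ι ω (coordMap i ^ (m + 1) * q) →
      tripleSum ω i j k (tripleSum ω i j k x) -
        ((1 - collisionEigenvalue (m + 1)) + (1 + 2 * collisionEigenvalue (m + 1))) •
          tripleSum ω i j k x +
        ((1 - collisionEigenvalue (m + 1)) * (1 + 2 * collisionEigenvalue (m + 1))) • x ∈
      (blockFiltration T m).map (contToL2 ι ω) := by
    rintro i j k hij hik hjk hT hA q hq x rfl
    have h1 := tripleSum_leading (ω := ω) hij hik hjk hT hq m
    have h2 := tripleSum_leading (ω := ω) hjk hij.symm hik.symm (T := T)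
      (by rw [hT]; ext x; simp; tauto) hq m
    have h3 := tripleSum_leading (ω := ω) hik.symm hjk.symm hij (T := T)
      (by rw [hT]; ext x; simp; tauto) hq m
    rw [tripleSum_rotate i j k] at h1 hA ⊢
    rw [tripleSum_rotate k i j, tripleSum_rotate i j k] at h3
    rw [add_right_comm] at h2
    exact quadratic_mem (A := (tripleSum ω j k i).toLinearMap) hA h1 h2 h3
  rintro _ ⟨g, hg, rfl⟩
  induction hg using Submodule.span_induction with
  | mem x hx =>
    obtain ⟨a, ha, l, hl, q, hq, rfl⟩ := hx
    rcases Nat.lt_or_ge m l with hlm | hlm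
    · obtain rfl : l = m + 1 := by omega
      rw [hT] at ha
      simp only [Finset.mem_insert, Finset.mem_singleton] at ha
      rcases ha with rfl | rfl | rfl
      · exact hgen hij hik hjk hT hA q hq _ rfl
      · rw [tripleSum_rotate] at hA ⊢
        exact hgen hjk hij.symm hik.symm (by rw [hT]; ext x; simp; tauto) hA q hq _ rfl
      · rw [tripleSum_rotate, tripleSum_rotate] at hA ⊢
        exact hgen hik.symm hjk.symm hij (by rw [hT]; ext x; simp; tauto) hA q hq _ rfl
    · have hmem : contToL2 ι ω (coordMap a ^ l * q) ∈ (blockFiltration T m).map (contToL2 ι ω) :=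
        Submodule.mem_map_of_mem (mem_blockFiltration ha hlm hq)
      exact Submodule.add_mem _ (Submodule.sub_mem _ (hA _ (hA _ hmem))
        (Submodule.smul_mem _ _ (hA _ hmem))) (Submodule.smul_mem _ _ hmem)
  | zero => simp
  | add x y _ _ hx hy =>
    convert! Submodule.add_mem _ hx hy using 1
    simp only [map_add]
    module
  | smul c x _ hx =>
    convert! Submodule.smul_mem _ c hx using 1
    simp only [map_smul]
    module

lemma separatesPoints_adjoin_coordMap :
    (Algebra.adjoin ℝ (Set.range (coordMap (ι := ι)))).SeparatesPoints := by
  intro x y hxy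
  obtain ⟨a, ha⟩ : ∃ a, x a ≠ y a := by
    by_contra h
    push Not at h
    exact hxy (by ext a; exact h a)
  exact ⟨coordMap a, ⟨_, Algebra.subset_adjoin ⟨a, rfl⟩, rfl⟩, ha⟩

lemma exists_monomial {i j k : ι} {T : Finset ι} (hT : T = {i, j, k})
    {g : C(EuclideanSpace ℝ ι, ℝ)} (hg : g ∈ Submonoid.closure (Set.range (coordMap (ι := ι)))) :
    ∃ p r t : ℕ, ∃ q ∈ blockInvariants T,
      g = coordMap i ^ p * coordMap j ^ r * coordMap k ^ t * q := by
  induction hg using Submonoid.closure_induction with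
  | mem x hx =>
    obtain ⟨a, rfl⟩ := hx
    by_cases ha : a ∈ T
    · rw [hT] at ha
      simp only [Finset.mem_insert, Finset.mem_singleton] at ha
      rcases ha with rfl | rfl | rfl
      · exact ⟨1, 0, 0, 1, one_mem _, by simp⟩
      · exact ⟨0, 1, 0, 1, one_mem _, by simp⟩
      · exact ⟨0, 0, 1, 1, one_mem _, by simp⟩
    · exact ⟨0, 0, 0, _, coordMap_mem_blockInvariants ha, by simp⟩
  | one => exact ⟨0, 0, 0, 1, one_mem _, by simp⟩
  | mul x y _ _ hx hy =>
    obtain ⟨p, r, t, q, hq, rfl⟩ := hx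
    obtain ⟨p', r', t', q', hq', rfl⟩ := hy
    exact ⟨p + p', r + r', t + t', q * q', mul_mem hq hq', by simp only [pow_add]; ring⟩

/-- Polynomials are dense, and each pair average sends a monomial into some level of the filtration.
This is why nothing outside the filtration needs to be diagonalised. -/
lemma tripleSum_mem_closure {i j k : ι} (hij : i ≠ j) (hik : i ≠ k) (hjk : j ≠ k) {T : Finset ι}
    (hT : T = {i, j, k}) (f : SphereL2 ι ω) : tripleSum ω i j k f ∈
      (⨆ m, (blockFiltration T m).map (contToL2 ι ω)).topologicalClosure := by
  set S := ⨆ m, (blockFiltration T m).map (contToL2 ι ω)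
  have hle : ∀ m, (blockFiltration T m).map (contToL2 ι ω) ≤ S := le_iSup _
  have hpoly : ∀ g ∈ Submodule.span ℝ
      (Submonoid.closure (Set.range (coordMap (ι := ι))) : Set C(EuclideanSpace ℝ ι, ℝ)),
      tripleSum ω i j k (contToL2 ι ω g) ∈ S := by
    intro g hg
    induction hg using Submodule.span_induction with
    | mem x hx =>
      obtain ⟨p, r, t, q, hq, rfl⟩ := exists_monomial hT hx
      have h1 := hle _ (rotAverage_monomial_mem (ω := ω) hij hik hjk hT hq p r t)
      have h2 := hle _ (rotAverage_monomial_mem (ω := ω) hjk hij.symm hik.symm (T := T)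
        (by rw [hT]; ext x; simp; tauto) hq r t p)
      have h3 := hle _ (rotAverage_monomial_mem (ω := ω) hik hij hjk.symm (T := T)
        (by rw [hT]; ext x; simp; tauto) hq p t r)
      rw [show coordMap j ^ r * coordMap k ^ t * coordMap i ^ p * q =
        coordMap i ^ p * coordMap j ^ r * coordMap k ^ t * q by ring] at h2
      rw [show coordMap i ^ p * coordMap k ^ t * coordMap j ^ r * q =
        coordMap i ^ p * coordMap j ^ r * coordMap k ^ t * q by ring] at h3
      rw [tripleSum_apply]
      exact S.add_mem (S.add_mem h1 h2) h3
    | zero => simp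
    | add x y _ _ hx hy => rw [map_add, map_add]; exact S.add_mem hx hy
    | smul c x _ hx => rw [map_smul, map_smul]; exact S.smul_mem _ hx
  have hmaps : Set.MapsTo (tripleSum ω i j k)
      (contToL2 ι ω '' (Algebra.adjoin ℝ (Set.range (coordMap (ι := ι))))) S := by
    rintro _ ⟨g, hg, rfl⟩
    refine hpoly g ?_
    rw [← Algebra.adjoin_eq_span]
    exact hg
  exact map_mem_closure (tripleSum ω i j k).continuous
    (dense_contToL2_image separatesPoints_adjoin_coordMap f) hmaps

/-- The spectral gap for three particles, as an inequality for the square of the generator. -/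
lemma three_particle_gap {i j k : ι} (hij : i ≠ j) (hik : i ≠ k) (hjk : j ≠ k)
    (f : SphereL2 ι ω) :
    5 / 4 * (‖f - rotAverage ω i j f‖ ^ 2 + ‖f - rotAverage ω j k f‖ ^ 2 +
      ‖f - rotAverage ω i k f‖ ^ 2) ≤
    ‖(f - rotAverage ω i j f) + (f - rotAverage ω j k f) + (f - rotAverage ω i k f)‖ ^ 2 := by
  set T : Finset ι := {i, j, k} with hT
  set A := tripleSum ω i j k with hA
  set F : ℕ → Submodule ℝ (SphereL2 ι ω) := fun m => (blockFiltration T m).map (contToL2 ι ω)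
    with hF
  have : CompleteSpace (F 0).topologicalClosure :=
    (Submodule.isClosed_topologicalClosure _).completeSpace_coe
  set Z := (F 0).topologicalClosure
  -- The bottom level consists of functions fixed by all three averages, so subtracting `z` leaves
  -- every defect unchanged.
  set z := Z.starProjection f with hz
  have hZinv : ∀ {a b : ι}, a ∈ T → b ∈ T → ∀ x ∈ Z, rotAverage ω a b x = x := by
    intro a b ha hb x hx
    refine Submodule.starProjection_eq_self_iff.2 ?_
    have hle : F 0 ≤ rotInvariants ω a b := by
      rw [hF, Submodule.map_le_iff_le_comap, blockFiltration, Submodule.span_le]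
      rintro g ⟨c, hc, l, hl, q, hq, rfl⟩
      obtain rfl : l = 0 := by omega
      rw [pow_zero, one_mul]
      have h : rotAverage ω a b (contToL2 ι ω q) = contToL2 ι ω q :=
        rotAverage_contToL2 a b fun η => by simp [rotMean, hq a ha b hb]
      exact Submodule.starProjection_eq_self_iff.1 h
    exact Submodule.topologicalClosure_minimal _ hle (isClosed_rotInvariants a b) hx
  have hzZ : z ∈ Z := Z.starProjection_apply_mem f
  have z1 := hZinv (a := i) (b := j) (by simp [hT]) (by simp [hT]) z hzZ
  have z2 := hZinv (a := j) (b := k) (by simp [hT]) (by simp [hT]) z hzZ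
  have z3 := hZinv (a := i) (b := k) (by simp [hT]) (by simp [hT]) z hzZ
  set g := f - z with hg
  have hg0 : ∀ x ∈ F 0, ⟪x, g⟫_ℝ = 0 := by
    intro x hx
    rw [real_inner_comm]
    exact Z.starProjection_inner_eq_zero f x (Submodule.le_topologicalClosure _ hx)
  have hmain : ⟪g, A g⟫_ℝ ≤ 7 / 4 * ‖g‖ ^ 2 :=
    inner_apply_le_of_filtration (tripleSum_symm i j k)
      (F := F) (fun m => Submodule.map_mono (blockFiltration_mono T (Nat.le_succ m)))
      (tripleSum_mem hij hik hjk hT) (C := 7 / 4) (by norm_num)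
      (fun m => (collisionEigenvalue_bounds (Nat.succ_le_succ (Nat.zero_le m))).1)
      (fun m => (collisionEigenvalue_bounds (Nat.succ_le_succ (Nat.zero_le m))).2)
      (tripleSum_quadratic_mem hij hik hjk hT) (tripleSum_mem_closure hij hik hjk hT) hg0
  have e1 : f - rotAverage ω i j f = g - rotAverage ω i j g := by rw [hg, map_sub, z1]; abel
  have e2 : f - rotAverage ω j k f = g - rotAverage ω j k g := by rw [hg, map_sub, z2]; abel
  have e3 : f - rotAverage ω i k f = g - rotAverage ω i k g := by rw [hg, map_sub, z3]; abel
  rw [e1, e2, e3]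
  set B := (g - rotAverage ω i j g) + (g - rotAverage ω j k g) + (g - rotAverage ω i k g) with hB
  have hsum : ‖g - rotAverage ω i j g‖ ^ 2 + ‖g - rotAverage ω j k g‖ ^ 2 +
      ‖g - rotAverage ω i k g‖ ^ 2 = ⟪g, B⟫_ℝ := by
    rw [hB, inner_add_right, inner_add_right, inner_sub_rotAverage, inner_sub_rotAverage,
      inner_sub_rotAverage]
  have hB' : ⟪g, B⟫_ℝ = 3 * ‖g‖ ^ 2 - ⟪g, A g⟫_ℝ := by
    have : B = (3 : ℝ) • g - A g := by
      rw [hB, hA, tripleSum_apply]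
      module
    rw [this, inner_sub_right, real_inner_smul_right, real_inner_self_eq_norm_sq]
  rw [hsum]
  -- Here `5/4 = 3 - 7/4`. With Cauchy–Schwarz this gives `‖B‖ ≥ (5/4) ‖g‖`, hence `‖B‖² ≥ (5/4) ⟪g,
  -- B⟫`.
  have h1 : 5 / 4 * ‖g‖ ^ 2 ≤ ⟪g, B⟫_ℝ := by rw [hB']; linarith
  have h2 : ⟪g, B⟫_ℝ ≤ ‖g‖ * ‖B‖ := real_inner_le_norm g B
  rcases (norm_nonneg g).eq_or_lt with h0 | h0
  · have h3 : ⟪g, B⟫_ℝ ≤ 0 := by rw [← h0, zero_mul] at h2; exact h2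
    nlinarith [sq_nonneg ‖B‖]
  · have h3 : 5 / 4 * ‖g‖ ≤ ‖B‖ := by nlinarith
    nlinarith [norm_nonneg B]

end ThreeParticleGap

/-! ### From triples to all pairs. -/

section PairSums

variable {H : Type*} [NormedAddCommGroup H] [InnerProductSpace ℝ H]

/-- Lower bound for the square of a sum over pairs, from a bound on triples and the positivity of
the products of disjoint pairs. -/
lemma pair_sum_sq_lower_bound {ι : Type*} [Fintype ι] [DecidableEq ι] (p : ι → ι → H)
    (hsymm : ∀ i j, p i j = p j i) (hdiag : ∀ i, p i i = 0)
    (hdisj : ∀ i j k l, i ≠ k → i ≠ l → j ≠ k → j ≠ l → 0 ≤ ⟪p i j, p k l⟫_ℝ)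
    (htriple : ∀ i j k, i ≠ j → i ≠ k → j ≠ k →
      5 / 4 * (‖p i j‖ ^ 2 + ‖p j k‖ ^ 2 + ‖p i k‖ ^ 2) ≤ ‖p i j + p j k + p i k‖ ^ 2) :
    (Fintype.card ι : ℝ) / 2 * ∑ i, ∑ j, ‖p i j‖ ^ 2 ≤ ‖∑ i, ∑ j, p i j‖ ^ 2 := by
  set S : ℝ := ∑ i, ∑ j, ‖p i j‖ ^ 2 with hS
  set T : ℝ := ∑ i, ∑ j, ∑ k, ⟪p i j, p i k⟫_ℝ with hT
  have hw : ∀ i j, ⟪p i j, p i j⟫_ℝ = ‖p i j‖ ^ 2 := fun i j => real_inner_self_eq_norm_sq _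
  have hT2 : ∑ i, ∑ j, ∑ k, ⟪p i j, p j k⟫_ℝ = T := by
    rw [Finset.sum_comm]
    refine Finset.sum_congr rfl fun i _ => Finset.sum_congr rfl fun j _ =>
      Finset.sum_congr rfl fun k _ => ?_
    rw [hsymm j i]
  have hT3 : ∑ i, ∑ j, ∑ k, ⟪p j k, p i k⟫_ℝ = T := by
    have : ∀ i, ∑ j, ∑ k, ⟪p j k, p i k⟫_ℝ = ∑ k, ∑ j, ⟪p j k, p i k⟫_ℝ := fun i =>
      Finset.sum_comm
    simp only [this]
    rw [Finset.sum_comm]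
    refine Finset.sum_congr rfl fun i _ => ?_
    rw [Finset.sum_comm]
    refine Finset.sum_congr rfl fun j _ => Finset.sum_congr rfl fun k _ => ?_
    rw [hsymm j i, hsymm k i]
  -- For distinct indices this is the triple bound with the squares subtracted. The indicator terms
  -- record what is gained when two indices coincide, so that the sum runs over all `i, j, k`.
  have hlocal : ∀ i j k, 1 / 4 * (‖p i j‖ ^ 2 + ‖p j k‖ ^ 2 + ‖p i k‖ ^ 2) +
      ((if i = j then ‖p i k‖ ^ 2 else 0) + (if j = k then ‖p i j‖ ^ 2 else 0) +
        (if i = k then ‖p i j‖ ^ 2 else 0)) ≤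
      2 * (⟪p i j, p j k⟫_ℝ + ⟪p i j, p i k⟫_ℝ + ⟪p j k, p i k⟫_ℝ) := by
    intro i j k
    have h0 : ∀ i j, 0 ≤ ‖p i j‖ ^ 2 := fun i j => sq_nonneg _
    by_cases hij : i = j
    · subst hij
      by_cases hik : i = k
      · subst hik; simp [hdiag]
      · simp only [hdiag, if_true, hik, if_false, hw, norm_zero, inner_zero_left]
        nlinarith [h0 i k]
    · by_cases hjk : j = k
      · subst hjk
        simp only [hdiag, if_true, hij, if_false, hw, norm_zero, inner_zero_left, inner_zero_right]
        nlinarith [h0 i j]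
      · by_cases hik : i = k
        · subst hik
          simp only [hdiag, if_true, hij, hjk, if_false, hsymm j i, hw, norm_zero,
            inner_zero_right]
          nlinarith [h0 i j]
        · have h := htriple i j k hij hik hjk
          rw [norm_add_sq_real, norm_add_sq_real, inner_add_left] at h
          simp only [hij, hjk, hik, if_false]
          linarith
  have hT6 : 3 / 4 * (Fintype.card ι : ℝ) * S + 3 * S ≤ 6 * T := by
    have hsum := Finset.sum_le_sum fun i (_ : i ∈ Finset.univ) =>
      Finset.sum_le_sum fun j (_ : j ∈ Finset.univ) =>
      Finset.sum_le_sum fun k (_ : k ∈ Finset.univ) => hlocal i j k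
    simp only [Finset.sum_add_distrib, ← Finset.mul_sum, hT2, hT3] at hsum
    have e1 : ∑ i, ∑ j, ∑ _k : ι, ‖p i j‖ ^ 2 = (Fintype.card ι : ℝ) * S := by
      simp [hS, Finset.mul_sum]
    have e2 : ∑ _i : ι, ∑ j, ∑ k, ‖p j k‖ ^ 2 = (Fintype.card ι : ℝ) * S := by
      simp [hS]
    have e3 : ∑ i, ∑ _j : ι, ∑ k, ‖p i k‖ ^ 2 = (Fintype.card ι : ℝ) * S := by
      simp [hS, Finset.mul_sum]
    have e4 : ∑ i, ∑ j, ∑ k, (if i = j then ‖p i k‖ ^ 2 else 0) = S := by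
      rw [hS]
      refine Finset.sum_congr rfl fun i _ => ?_
      rw [Finset.sum_comm]
      simp
    have e5 : ∑ i, ∑ j, ∑ k, (if j = k then ‖p i j‖ ^ 2 else 0) = S := by
      simp [hS]
    have e6 : ∑ i, ∑ j, ∑ k, (if i = k then ‖p i j‖ ^ 2 else 0) = S := by
      simp [hS]
    rw [e1, e2, e3, e4, e5, e6] at hsum
    linarith
  -- Inclusion–exclusion over the coincidences of the two pairs: four ways to share an index, with
  -- the two ways of sharing both counted twice. Disjoint pairs are dropped by positivity.
  have hpoint : ∀ i j k l, (if k = i then ⟪p i j, p k l⟫_ℝ else 0) +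
      (if k = j then ⟪p i j, p k l⟫_ℝ else 0) + (if l = i then ⟪p i j, p k l⟫_ℝ else 0) +
      (if l = j then ⟪p i j, p k l⟫_ℝ else 0) -
      (if k = i then (if l = j then ⟪p i j, p k l⟫_ℝ else 0) else 0) -
      (if k = j then (if l = i then ⟪p i j, p k l⟫_ℝ else 0) else 0) ≤ ⟪p i j, p k l⟫_ℝ := by
    intro i j k l
    by_cases hij : i = j
    · subst hij; simp [hdiag]
    by_cases hkl : k = l
    · subst hkl; simp [hdiag]
    by_cases hki : k = i
    · subst hki
      by_cases hlj : l = j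
      · subst hlj; simp [hkl, Ne.symm hkl]
      · simp [hlj, hij, Ne.symm hkl]
    by_cases hkj : k = j
    · subst hkj
      by_cases hli : l = i
      · subst hli; simp [hkl, Ne.symm hkl]
      · simp [hli, hki, Ne.symm hkl]
    by_cases hli : l = i
    · subst hli; simp [hkl, hkj, hij]
    by_cases hlj : l = j
    · subst hlj; simp [hki, hkj, hli]
    · simpa [hki, hkj, hli, hlj] using
        hdisj i j k l (Ne.symm hki) (Ne.symm hli) (Ne.symm hkj) (Ne.symm hlj)
  have hsq : ‖∑ i, ∑ j, p i j‖ ^ 2 = ∑ i, ∑ j, ∑ k, ∑ l, ⟪p i j, p k l⟫_ℝ := by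
    rw [← real_inner_self_eq_norm_sq]
    simp only [sum_inner, inner_sum]
    exact Finset.sum_congr rfl fun i _ => Finset.sum_congr rfl fun j _ =>
      Finset.sum_congr rfl fun k _ => Finset.sum_congr rfl fun l _ => real_inner_comm _ _
  have hmain : 4 * T - 2 * S ≤ ‖∑ i, ∑ j, p i j‖ ^ 2 := by
    have hsum := Finset.sum_le_sum fun i (_ : i ∈ Finset.univ) =>
      Finset.sum_le_sum fun j (_ : j ∈ Finset.univ) =>
      Finset.sum_le_sum fun k (_ : k ∈ Finset.univ) =>
      Finset.sum_le_sum fun l (_ : l ∈ Finset.univ) => hpoint i j k l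
    simp only [Finset.sum_add_distrib, Finset.sum_sub_distrib] at hsum
    rw [← hsq] at hsum
    have e1 : ∑ i, ∑ j, ∑ k, ∑ l, (if k = i then ⟪p i j, p k l⟫_ℝ else 0) = T := by
      rw [hT]
      refine Finset.sum_congr rfl fun i _ => Finset.sum_congr rfl fun j _ => ?_
      rw [Finset.sum_comm]
      simp
    have e2 : ∑ i, ∑ j, ∑ k, ∑ l, (if k = j then ⟪p i j, p k l⟫_ℝ else 0) = T := by
      rw [← hT2]
      refine Finset.sum_congr rfl fun i _ => Finset.sum_congr rfl fun j _ => ?_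
      rw [Finset.sum_comm]
      simp
    have e3 : ∑ i, ∑ j, ∑ k, ∑ l, (if l = i then ⟪p i j, p k l⟫_ℝ else 0) = T := by
      rw [hT]
      refine Finset.sum_congr rfl fun i _ => Finset.sum_congr rfl fun j _ =>
        Finset.sum_congr rfl fun k _ => ?_
      simp [hsymm k i]
    have e4 : ∑ i, ∑ j, ∑ k, ∑ l, (if l = j then ⟪p i j, p k l⟫_ℝ else 0) = T := by
      rw [← hT2]
      refine Finset.sum_congr rfl fun i _ => Finset.sum_congr rfl fun j _ =>
        Finset.sum_congr rfl fun k _ => ?_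
      simp [hsymm k j]
    have e5 : ∑ i, ∑ j, ∑ k, ∑ l, (if k = i then (if l = j then ⟪p i j, p k l⟫_ℝ else 0) else 0)
        = S := by
      rw [hS]
      refine Finset.sum_congr rfl fun i _ => Finset.sum_congr rfl fun j _ => ?_
      rw [Finset.sum_comm]
      simp
    have e6 : ∑ i, ∑ j, ∑ k, ∑ l, (if k = j then (if l = i then ⟪p i j, p k l⟫_ℝ else 0) else 0)
        = S := by
      rw [hS]
      refine Finset.sum_congr rfl fun i _ => Finset.sum_congr rfl fun j _ => ?_
      rw [Finset.sum_comm]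
      simp [hsymm j i]
    rw [e1, e2, e3, e4, e5, e6] at hsum
    linarith
  -- `T ≥ (n/8 + 1/2) S` turns `4T - 2S` into at least `(n/2) S`.
  linarith

end PairSums

/-! ### The gap of the mean-field operator. -/

section MeanFieldGap

variable {ι : Type} [Fintype ι] [DecidableEq ι] {ω : ℝ}

/-- The sum of `1 - E_{i,j}` over all ordered pairs. -/
def pairDefect (ι : Type) [Fintype ι] [DecidableEq ι] (ω : ℝ) : SphereL2 ι ω →L[ℝ] SphereL2 ι ω :=
  ∑ i, ∑ j, (ContinuousLinearMap.id ℝ _ - rotAverage ω i j)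

lemma pairDefect_apply (f : SphereL2 ι ω) :
    pairDefect ι ω f = ∑ i, ∑ j, (f - rotAverage ω i j f) := by
  simp [pairDefect]

lemma inner_pairDefect (f : SphereL2 ι ω) :
    ⟪f, pairDefect ι ω f⟫_ℝ = ∑ i, ∑ j, ‖f - rotAverage ω i j f‖ ^ 2 := by
  simp only [pairDefect_apply, inner_sum, inner_sub_rotAverage]

lemma pairDefect_symm (f g : SphereL2 ι ω) :
    ⟪pairDefect ι ω f, g⟫_ℝ = ⟪f, pairDefect ι ω g⟫_ℝ := by
  simp only [pairDefect_apply, inner_sum, sum_inner, inner_sub_left, inner_sub_right,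
    rotAverage_symm]

variable [Nonempty ι]

lemma pairDefect_sq (f : SphereL2 ι ω) :
    (Fintype.card ι : ℝ) / 2 * ⟪f, pairDefect ι ω f⟫_ℝ ≤ ‖pairDefect ι ω f‖ ^ 2 := by
  rw [inner_pairDefect, pairDefect_apply]
  exact pair_sum_sq_lower_bound (fun i j => f - rotAverage ω i j f)
    (fun i j => by rw [rotAverage_comm]) (fun i => by rw [rotAverage_self, sub_self])
    (fun i j k l h1 h2 h3 h4 => inner_sub_rotAverage_nonneg h1 h2 h3 h4 f)
    (fun i j k h1 h2 h3 => three_particle_gap h1 h2 h3 f)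

/-- The spectral gap of the mean-field operator. -/
lemma pairDefect_gap [Nontrivial ι] (hω : 0 < ω) {f : SphereL2 ι ω}
    (hf : ∫ η, f η ∂(sphereUniform ι ω) = 0) :
    (Fintype.card ι : ℝ) / 2 * ‖f‖ ^ 2 ≤ ∑ i, ∑ j, ‖f - rotAverage ω i j f‖ ^ 2 := by
  rw [← inner_pairDefect]
  refine le_inner_apply_of_orthogonal_ker pairDefect_symm (fun x => ?_) pairDefect_sq
    (by have := Fintype.card_pos (α := ι); positivity) fun g hg => ?_
  · rw [inner_pairDefect]; positivity
  -- A kernel vector has every defect zero, hence is invariant under all rotations and constant; `f`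
  -- is orthogonal to constants.
  · have hg0 : ∑ i, ∑ j, ‖g - rotAverage ω i j g‖ ^ 2 = 0 := by
      rw [← inner_pairDefect, hg, inner_zero_right]
    have hinv : ∀ i j, g ∈ rotInvariants ω i j := by
      intro i j
      have h1 := (Finset.sum_eq_zero_iff_of_nonneg (fun i _ => Finset.sum_nonneg
        fun j _ => sq_nonneg _)).1 hg0 i (Finset.mem_univ i)
      have h2 := (Finset.sum_eq_zero_iff_of_nonneg (fun j _ => sq_nonneg _)).1 h1 j
        (Finset.mem_univ j)
      have h3 : g - rotAverage ω i j g = 0 := by simpa using h2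
      rw [sub_eq_zero.1 h3]
      exact rotAverage_mem i j g
    set m := ∫ η, g η ∂(sphereUniform ι ω) with hm
    set u : SphereL2 ι ω := contToL2 ι ω 1 with hu
    have huc : u =ᵐ[sphereUniform ι ω] fun _ => (1 : ℝ) := coeFn_contToL2 1
    have huinv : ∀ i j, u ∈ rotInvariants ω i j := fun i j => by
      have h : rotAverage ω i j u = u := rotAverage_contToL2 i j fun η => by simp [rotMean]
      exact Submodule.starProjection_eq_self_iff.1 h
    have hgm : g - m • u = 0 := by
      refine eq_zero_of_rotation_invariant hω
        (fun i j => Submodule.sub_mem _ (hinv i j) (Submodule.smul_mem _ _ (huinv i j))) ?_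
      have hae : (g - m • u : SphereL2 ι ω) =ᵐ[sphereUniform ι ω] fun η => g η - m := by
        filter_upwards [Lp.coeFn_sub g (m • u), Lp.coeFn_smul m u, huc] with η h1 h2 h3
        rw [h1, Pi.sub_apply, h2, Pi.smul_apply, h3]
        simp
      rw [integral_congr_ae hae, integral_sub ((Lp.memLp g).integrable (by norm_num))
        (integrable_const _)]
      simp [hm]
    rw [sub_eq_zero.1 hgm, real_inner_smul_right, hu, inner_contToL2]
    simp [hf]

end MeanFieldGap

/-! ### Path comparison on the cube. -/

section CubePaths

variable {d N : ℕ}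

/-- Only the newly added step is charged twice, so the factor `2` does not compound along the path.
-/
lemma chain_le {α : Type*} {a : α → α → ℝ} (hself : ∀ x, a x x = 0)
    (htri : ∀ x y z, a x z ≤ a x y + 2 * a y z) (w : ℕ → α) {p q : ℕ} (hpq : p ≤ q) :
    a (w p) (w q) ≤ 2 * ∑ m ∈ Finset.Ico p q, a (w m) (w (m + 1)) := by
  induction q, hpq using Nat.le_induction with
  | base => simp [hself]
  | succ q hpq ih =>
    rw [Finset.sum_Ico_succ_top hpq, mul_add]
    linarith [htri (w p) (w q) (w (q + 1))]

/-- The upper neighbour in direction `i`, or the point itself at the boundary. -/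
def Cube.up (z : Cube d N) (i : Fin d) : Cube d N :=
  if h : (z i : ℕ) + 1 < N then Function.update z i ⟨z i + 1, h⟩ else z

lemma Cube.dist_up {z : Cube d N} {i : Fin d} (h : (z i : ℕ) + 1 < N) :
    Cube.dist z (z.up i) = 1 := by
  rw [Cube.dist, Cube.up, dif_pos h, Finset.sum_eq_single i]
  · simp
  · intro j _ hj
    simp [hj]
  · simp

/-- At the boundary `up` returns `z` itself and contributes zero; otherwise distinct directions give
distinct neighbours. -/
lemma sum_up_sq_le {a : Cube d N → Cube d N → ℝ} (hself : ∀ x, a x x = 0) (z : Cube d N) :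
    ∑ i, a z (z.up i) ^ 2 ≤ ∑ y : Cube d N with Cube.dist z y = 1, a z y ^ 2 := by
  have h1 : ∑ i, a z (z.up i) ^ 2 = ∑ i with (z i : ℕ) + 1 < N, a z (z.up i) ^ 2 := by
    rw [Finset.sum_filter]
    refine Finset.sum_congr rfl fun i _ => ?_
    split_ifs with h
    · rfl
    · simp [Cube.up, h, hself]
  rw [h1, ← Finset.sum_image (f := fun y => a z y ^ 2) (g := fun i => z.up i)]
  · refine Finset.sum_le_sum_of_subset_of_nonneg ?_ fun _ _ _ => sq_nonneg _
    intro y hy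
    obtain ⟨i, hi, rfl⟩ := Finset.mem_image.1 hy
    simp only [Finset.mem_filter, Finset.mem_univ, true_and] at hi ⊢
    exact Cube.dist_up hi
  · intro i hi j hj hij
    simp only [Finset.coe_filter, Finset.mem_univ, true_and, Set.mem_ofPred_eq] at hi hj
    by_contra hne
    have := congrFun hij i
    simp only [Cube.up, dif_pos hi, dif_pos hj, Function.update_self,
      Function.update_of_ne hne, Fin.ext_iff] at this
    omega

/-- The bound runs over the whole line rather than the segment used, so it does not depend on `t`
and can be summed freely. -/
lemma line_le {a : Cube d N → Cube d N → ℝ} (hnn : ∀ x y, 0 ≤ a x y) (hself : ∀ x, a x x = 0)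
    (hsymm : ∀ x y, a x y = a y x) (htri : ∀ x y z, a x z ≤ a x y + 2 * a y z) (u : Cube d N)
    (i : Fin d) (t : Fin N) : a u (Function.update u i t) ≤
      2 * ∑ m : Fin N, a (Function.update u i m) (Cube.up (Function.update u i m) i) := by
  have key : ∀ p q : Fin N, p ≤ q → a (Function.update u i p) (Function.update u i q) ≤
      2 * ∑ m : Fin N, a (Function.update u i m) (Cube.up (Function.update u i m) i) := by
    intro p q hpq
    set w : ℕ → Cube d N := fun m => if h : m < N then Function.update u i ⟨m, h⟩ else u with hw
    have hwp : ∀ p : Fin N, w p = Function.update u i p := fun p => by simp [hw]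
    have hup : ∀ m, m + 1 < N → w (m + 1) = (w m).up i := by
      intro m hm
      have hm' : m < N := by omega
      simp [hw, hm, hm', Cube.up]
    have h := chain_le hself htri w hpq
    rw [hwp, hwp] at h
    refine h.trans (mul_le_mul_of_nonneg_left ?_ zero_le_two)
    calc ∑ m ∈ Finset.Ico (p : ℕ) q, a (w m) (w (m + 1))
        = ∑ m ∈ Finset.Ico (p : ℕ) q, a (w m) ((w m).up i) := by
          refine Finset.sum_congr rfl fun m hm => ?_
          rw [hup m]
          have := (Finset.mem_Ico.1 hm).2
          omega
      _ ≤ ∑ m ∈ Finset.range N, a (w m) ((w m).up i) := by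
          refine Finset.sum_le_sum_of_subset_of_nonneg ?_ fun _ _ _ => hnn _ _
          intro m hm
          have := (Finset.mem_Ico.1 hm).2
          exact Finset.mem_range.2 (by omega)
      _ = _ := by
          rw [Finset.sum_range]
          simp only [hwp]
  have hu : u = Function.update u i (u i) := (Function.update_eq_self i u).symm
  rcases le_total (u i) t with h | h
  · have := key _ _ h
    rwa [← hu] at this
  · have := key _ _ h
    rwa [← hu, hsymm] at this

lemma sum_update_eq (i : Fin d) (g : Cube d N → ℝ) :
    ∑ u : Cube d N, ∑ m : Fin N, g (Function.update u i m) = N * ∑ z, g z := by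
  have hinv : Function.Involutive fun p : Cube d N × Fin N => (Function.update p.1 i p.2, p.1 i) := by
    rintro ⟨u, m⟩
    simp
  rw [← Fintype.sum_prod_type' (f := fun (u : Cube d N) (m : Fin N) => g (Function.update u i m)),
    ← Equiv.sum_comp (hinv.toPerm _)]
  simp only [Function.Involutive.coe_toPerm, Function.update_idem, Function.update_eq_self,
    Fintype.sum_prod_type]
  simp [Finset.mul_sum]

/-- The point whose coordinates before `k` are those of `y`, the others being those of `x`. -/
def Cube.mix (k : ℕ) (x y : Cube d N) : Cube d N := fun i => if (i : ℕ) < k then y i else x i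

/-- The new coordinate is just `y i`; writing it through `Cube.mix i y x` makes the step a function
of the mixed pair, ready for `sum_mix`. -/
lemma Cube.mix_succ (i : Fin d) (x y : Cube d N) :
    Cube.mix (i + 1) x y = Function.update (Cube.mix i x y) i (Cube.mix i y x i) := by
  ext j
  by_cases hj : j = i
  · subst hj; simp [Cube.mix]
  · have : (j : ℕ) ≠ i := fun h => hj (Fin.ext h)
    simp only [Cube.mix, Function.update_of_ne hj]
    have h2 : (j : ℕ) < i + 1 ↔ (j : ℕ) < i := by omega
    simp [h2]

/-- Exchanging the first `k` coordinates of `x` and `y` is an involution on pairs, so the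
intermediate points of the paths are spread uniformly. -/
lemma sum_mix (k : ℕ) (g : Cube d N → Cube d N → ℝ) :
    ∑ x, ∑ y, g (Cube.mix k x y) (Cube.mix k y x) = ∑ x, ∑ y, g x y := by
  have hinv : Function.Involutive fun p : Cube d N × Cube d N =>
      (Cube.mix k p.1 p.2, Cube.mix k p.2 p.1) := by
    rintro ⟨x, y⟩
    ext i <;> simp only [Cube.mix] <;> split_ifs <;> rfl
  rw [← Fintype.sum_prod_type' (f := g), ← Equiv.sum_comp (hinv.toPerm _), Fintype.sum_prod_type]
  rfl

/-- Comparison of all pairs with nearest neighbours by moving along the coordinate directions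
one after the other. -/
lemma sum_pairs_le_sum_neighbours {a : Cube d N → Cube d N → ℝ} (hnn : ∀ x y, 0 ≤ a x y)
    (hself : ∀ x, a x x = 0) (hsymm : ∀ x y, a x y = a y x)
    (htri : ∀ x y z, a x z ≤ a x y + 2 * a y z) :
    ∑ x, ∑ y, a x y ^ 2 ≤ 16 * d * N ^ 2 * N ^ d *
      ∑ x : Cube d N, ∑ y : Cube d N with Cube.dist x y = 1, a x y ^ 2 := by
  -- The `4` is the square of the path factor `2`, and `N` comes from Cauchy–Schwarz on the line;
  -- `hpath` repeats this with `d` directions.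
  have hline : ∀ (u : Cube d N) (i : Fin d) (t : Fin N), a u (Function.update u i t) ^ 2 ≤
      4 * N * ∑ m : Fin N,
        a (Function.update u i m) (Cube.up (Function.update u i m) i) ^ 2 := by
    intro u i t
    have h := pow_le_pow_left₀ (hnn _ _) (line_le hnn hself hsymm htri u i t) 2
    have h2 := sq_sum_le_card_mul_sum_sq (s := (Finset.univ : Finset (Fin N)))
      (f := fun m => a (Function.update u i m) (Cube.up (Function.update u i m) i))
    simp only [Finset.card_univ, Fintype.card_fin] at h2
    rw [mul_pow] at h
    linarith
  have hpath : ∀ x y : Cube d N, a x y ^ 2 ≤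
      4 * d * ∑ i : Fin d, a (Cube.mix i x y) (Cube.mix (i + 1) x y) ^ 2 := by
    intro x y
    have h0 := chain_le hself htri (fun k => Cube.mix k x y) (Nat.zero_le d)
    have e0 : Cube.mix 0 x y = x := by ext i; simp [Cube.mix]
    have e1 : Cube.mix d x y = y := by ext i; simp [Cube.mix]
    rw [e0, e1, ← Finset.range_eq_Ico, Finset.sum_range] at h0
    have h := pow_le_pow_left₀ (hnn _ _) h0 2
    have h2 := sq_sum_le_card_mul_sum_sq (s := (Finset.univ : Finset (Fin d)))
      (f := fun i => a (Cube.mix i x y) (Cube.mix (i + 1) x y))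
    simp only [Finset.card_univ, Fintype.card_fin] at h2
    rw [mul_pow] at h
    linarith
  have hdir : ∀ i : Fin d, ∑ x : Cube d N, ∑ y, a (Cube.mix i x y) (Cube.mix (i + 1) x y) ^ 2 ≤
      4 * N ^ 2 * N ^ d * ∑ z : Cube d N, a z (z.up i) ^ 2 := by
    intro i
    simp only [Cube.mix_succ]
    rw [sum_mix i (fun u v => a u (Function.update u i (v i)) ^ 2)]
    calc ∑ u : Cube d N, ∑ v : Cube d N, a u (Function.update u i (v i)) ^ 2
        ≤ ∑ u : Cube d N, ∑ _v : Cube d N, 4 * N * ∑ m : Fin N,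
          a (Function.update u i m) (Cube.up (Function.update u i m) i) ^ 2 :=
          Finset.sum_le_sum fun u _ => Finset.sum_le_sum fun v _ => hline u i (v i)
      _ = N ^ d * (4 * N * ∑ u : Cube d N, ∑ m : Fin N,
          a (Function.update u i m) (Cube.up (Function.update u i m) i) ^ 2) := by
          simp [Finset.mul_sum]
      _ = _ := by
          rw [sum_update_eq i (fun z => a z (z.up i) ^ 2)]
          ring
  calc ∑ x, ∑ y, a x y ^ 2
      ≤ ∑ x : Cube d N, ∑ y : Cube d N,
        4 * d * ∑ i : Fin d, a (Cube.mix i x y) (Cube.mix (i + 1) x y) ^ 2 :=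
        Finset.sum_le_sum fun x _ => Finset.sum_le_sum fun y _ => hpath x y
    _ = 4 * d * ∑ i : Fin d, ∑ x : Cube d N, ∑ y : Cube d N,
        a (Cube.mix i x y) (Cube.mix (i + 1) x y) ^ 2 := by
        simp only [← Finset.mul_sum]
        congr 1
        have : ∀ x : Cube d N, ∑ y : Cube d N, ∑ i : Fin d,
            a (Cube.mix i x y) (Cube.mix (i + 1) x y) ^ 2 =
            ∑ i : Fin d, ∑ y : Cube d N, a (Cube.mix i x y) (Cube.mix (i + 1) x y) ^ 2 :=
          fun x => Finset.sum_comm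
        simp only [this]
        exact Finset.sum_comm
    _ ≤ 4 * d * ∑ i : Fin d, 4 * N ^ 2 * N ^ d * ∑ z : Cube d N, a z (z.up i) ^ 2 :=
        mul_le_mul_of_nonneg_left (Finset.sum_le_sum fun i _ => hdir i) (by positivity)
    _ = 16 * d * N ^ 2 * N ^ d * ∑ z : Cube d N, ∑ i, a z (z.up i) ^ 2 := by
        rw [← Finset.mul_sum, Finset.sum_comm]
        ring
    _ ≤ _ := mul_le_mul_of_nonneg_left (Finset.sum_le_sum fun z _ => sum_up_sq_le hself z)
        (by positivity)

end CubePaths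

/-! ### Dirichlet forms as sums of squared defects. -/

section DirichletForms

variable {ι : Type} [Fintype ι] [DecidableEq ι] [Nonempty ι] {ω : ℝ}

lemma mul_collisionOp_ae_eq (i j : ι) {f : EuclideanSpace ℝ ι → ℝ}
    (hf : MemLp f 2 (sphereUniform ι ω)) :
    (fun η => f η * -collisionOp i j f η) =ᵐ[sphereUniform ι ω] fun η =>
      ⟪(hf.toLp : SphereL2 ι ω) η, (hf.toLp - rotAverage ω i j hf.toLp : SphereL2 ι ω) η⟫_ℝ := by
  filter_upwards [collisionOp_ae_eq i j hf, hf.coeFn_toLp] with η h1 h2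
  rw [h1, h2]
  simp [mul_comm]

lemma integrable_mul_collisionOp (i j : ι) {f : EuclideanSpace ℝ ι → ℝ}
    (hf : MemLp f 2 (sphereUniform ι ω)) :
    Integrable (fun η => f η * -collisionOp i j f η) (sphereUniform ι ω) :=
  (integrable_congr (mul_collisionOp_ae_eq i j hf)).2 (L2.integrable_inner _ _)

lemma integral_mul_collisionOp (i j : ι) {f : EuclideanSpace ℝ ι → ℝ}
    (hf : MemLp f 2 (sphereUniform ι ω)) :
    ∫ η, f η * -collisionOp i j f η ∂(sphereUniform ι ω) =
      ‖(hf.toLp - rotAverage ω i j hf.toLp : SphereL2 ι ω)‖ ^ 2 := by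
  rw [← inner_sub_rotAverage, L2.inner_def]
  exact integral_congr_ae (mul_collisionOp_ae_eq i j hf)

lemma integral_mul_neg_sum {f : EuclideanSpace ℝ ι → ℝ} (hf : MemLp f 2 (sphereUniform ι ω))
    (c : ℝ) (s : ι → Finset ι) :
    ∫ η, f η * -(c * ∑ i, ∑ j ∈ s i, collisionOp i j f η) ∂(sphereUniform ι ω) =
      c * ∑ i, ∑ j ∈ s i, ‖(hf.toLp - rotAverage ω i j hf.toLp : SphereL2 ι ω)‖ ^ 2 := by
  have e : ∀ η, f η * -(c * ∑ i, ∑ j ∈ s i, collisionOp i j f η) =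
      c * ∑ i, ∑ j ∈ s i, f η * -collisionOp i j f η := by
    intro η
    simp only [← Finset.mul_sum, Finset.sum_neg_distrib]
    ring
  simp only [e]
  rw [integral_const_mul, integral_finsetSum _ fun i _ => integrable_finsetSum _
    fun j _ => integrable_mul_collisionOp i j hf]
  congr 1
  refine Finset.sum_congr rfl fun i _ => ?_
  rw [integral_finsetSum _ fun j _ => integrable_mul_collisionOp i j hf]
  exact Finset.sum_congr rfl fun j _ => integral_mul_collisionOp i j hf

lemma integral_sq_eq_norm_toLp_sq {f : EuclideanSpace ℝ ι → ℝ}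
    (hf : MemLp f 2 (sphereUniform ι ω)) :
    ∫ η, f η ^ 2 ∂(sphereUniform ι ω) = ‖(hf.toLp : SphereL2 ι ω)‖ ^ 2 := by
  rw [← real_inner_self_eq_norm_sq, L2.inner_def]
  refine integral_congr_ae ?_
  filter_upwards [hf.coeFn_toLp] with η h
  rw [h]
  simp

/-- A coordinate function is a mean-zero function of positive variance. -/
lemma exists_admissible (hω : 0 < ω) : ∃ f : EuclideanSpace ℝ ι → ℝ,
    MemLp f 2 (sphereUniform ι ω) ∧ ∫ η, f η ∂(sphereUniform ι ω) = 0 ∧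
      ∫ η, f η ^ 2 ∂(sphereUniform ι ω) ≠ 0 := by
  have hmean : ∀ i : ι, ∫ η, coordMap i η ∂(sphereUniform ι ω) = 0 := by
    intro i
    have h := (measurePreserving_sphereUniform (LinearIsometryEquiv.neg ℝ) ω).integral_comp
      (LinearIsometryEquiv.neg ℝ (E := EuclideanSpace ℝ ι)).toHomeomorph.measurableEmbedding
      (coordMap i)
    simp only [coordMap, ContinuousMap.coe_mk, LinearIsometryEquiv.coe_neg, PiLp.neg_apply,
      integral_neg] at h
    simp only [coordMap, ContinuousMap.coe_mk]
    linarith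
  -- The second moments of the coordinates add up to `ω > 0`, so they cannot all vanish.
  by_contra hcon
  push Not at hcon
  have hzero : ∀ i : ι, ∫ η, coordMap i η ^ 2 ∂(sphereUniform ι ω) = 0 := fun i =>
    hcon _ (memLp_continuousMap (coordMap i)) (hmean i)
  have hsum : ∫ η, ∑ i, coordMap i η ^ 2 ∂(sphereUniform ι ω) = 0 := by
    rw [integral_finsetSum _ fun i _ => (memLp_continuousMap (coordMap i)).integrable_sq]
    exact Finset.sum_eq_zero fun i _ => hzero i
  have hω' : ∫ η, ∑ i, coordMap i η ^ 2 ∂(sphereUniform ι ω) = ω := by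
    have : (fun η => ∑ i, coordMap i η ^ 2) =ᵐ[sphereUniform ι ω] fun _ => ω := by
      filter_upwards [ae_norm_eq (ι := ι) ω] with η h
      have h2 := EuclideanSpace.norm_sq_eq η
      rw [h, Real.sq_sqrt hω.le] at h2
      rw [h2]
      simp [coordMap]
    rw [integral_congr_ae this]
    simp
  linarith

end DirichletForms

/-! ### Spectral gaps as infima of Rayleigh quotients. -/

section Gaps

lemma spectralGap_nonneg {Ω : Type} [MeasurableSpace Ω] {ν : Measure Ω} {L : (Ω → ℝ) → (Ω → ℝ)}
    (h : ∀ f, MemLp f 2 ν → 0 ≤ ∫ η, f η * (-(L f η)) ∂ν) : 0 ≤ spectralGap ν L := by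
  refine Real.sInf_nonneg ?_
  rintro r ⟨f, hf, -, -, rfl⟩
  exact div_nonneg (h f hf) (integral_nonneg fun η => sq_nonneg _)

lemma spectralGap_mul_le {Ω : Type} [MeasurableSpace Ω] {ν : Measure Ω}
    {L : (Ω → ℝ) → (Ω → ℝ)} (h : ∀ f, MemLp f 2 ν → 0 ≤ ∫ η, f η * (-(L f η)) ∂ν)
    {f : Ω → ℝ} (hf : MemLp f 2 ν) (hf0 : ∫ η, f η ∂ν = 0) :
    spectralGap ν L * ∫ η, f η ^ 2 ∂ν ≤ ∫ η, f η * (-(L f η)) ∂ν := by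
  by_cases h2 : ∫ η, f η ^ 2 ∂ν = 0
  · rw [h2, mul_zero]; exact h f hf
  · have hpos : 0 < ∫ η, f η ^ 2 ∂ν :=
      lt_of_le_of_ne (integral_nonneg fun η => sq_nonneg _) (Ne.symm h2)
    rw [← le_div_iff₀ hpos]
    refine csInf_le ⟨0, ?_⟩ ⟨f, hf, hf0, h2, rfl⟩
    rintro r ⟨g, hg, -, -, rfl⟩
    exact div_nonneg (h g hg) (integral_nonneg fun η => sq_nonneg _)

/-- An admissible function is required because the real infimum of the empty set is `0`. -/
lemma le_spectralGap {Ω : Type} [MeasurableSpace Ω] {ν : Measure Ω} {L : (Ω → ℝ) → (Ω → ℝ)}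
    {c : ℝ} (hne : ∃ f : Ω → ℝ, MemLp f 2 ν ∧ ∫ η, f η ∂ν = 0 ∧ ∫ η, f η ^ 2 ∂ν ≠ 0)
    (h : ∀ f : Ω → ℝ, MemLp f 2 ν → ∫ η, f η ∂ν = 0 →
      c * ∫ η, f η ^ 2 ∂ν ≤ ∫ η, f η * (-(L f η)) ∂ν) : c ≤ spectralGap ν L := by
  obtain ⟨f, hf, hf0, hf2⟩ := hne
  refine le_csInf ⟨_, f, hf, hf0, hf2, rfl⟩ ?_
  rintro r ⟨g, hg, hg0, hg2, rfl⟩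
  rw [le_div_iff₀ (lt_of_le_of_ne (integral_nonneg fun η => sq_nonneg _) (Ne.symm hg2))]
  exact h g hg hg0

lemma integral_mul_kacGenerator {n : ℕ} [NeZero n] {ω : ℝ} {f : EuclideanSpace ℝ (Fin n) → ℝ}
    (hf : MemLp f 2 (sphereUniform (Fin n) ω)) :
    ∫ η, f η * -(kacGenerator n f η) ∂(sphereUniform (Fin n) ω) = 1 / (2 * (n : ℝ)) *
      ∑ i, ∑ j, ‖(hf.toLp - rotAverage ω i j hf.toLp : SphereL2 (Fin n) ω)‖ ^ 2 :=
  integral_mul_neg_sum hf _ fun _ => Finset.univ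

lemma integral_mul_kacGenerator_nonneg {n : ℕ} [NeZero n] {ω : ℝ}
    (f : EuclideanSpace ℝ (Fin n) → ℝ) (hf : MemLp f 2 (sphereUniform (Fin n) ω)) :
    0 ≤ ∫ η, f η * -(kacGenerator n f η) ∂(sphereUniform (Fin n) ω) := by
  rw [integral_mul_kacGenerator hf]
  positivity

instance nonempty_posReal : Nonempty {ω : ℝ // 0 < ω} := ⟨⟨1, one_pos⟩⟩

/-- The spectral gap of the Kac walk is at least `1 / 4`. -/
lemma kacGap_ge {n : ℕ} (hn : 2 ≤ n) : 1 / 4 ≤ kacGap n := by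
  have : NeZero n := ⟨by omega⟩
  have : Nontrivial (Fin n) := Fin.nontrivial_iff_two_le.2 hn
  have hn0 : (0 : ℝ) < n := by exact_mod_cast (by omega : 0 < n)
  refine le_ciInf fun ω => le_spectralGap (exists_admissible ω.2) fun f hf hf0 => ?_
  rw [integral_mul_kacGenerator hf, integral_sq_eq_norm_toLp_sq hf]
  have hF0 : ∫ η, (hf.toLp : SphereL2 (Fin n) ω) η ∂(sphereUniform (Fin n) ω) = 0 := by
    rw [integral_congr_ae hf.coeFn_toLp, hf0]
  have h := mul_le_mul_of_nonneg_left (pairDefect_gap ω.2 hF0)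
    (by positivity : 0 ≤ 1 / (2 * (n : ℝ)))
  refine le_trans (le_of_eq ?_) h
  rw [Fintype.card_fin]
  field_simp
  ring

lemma kacGap_mul_le {n : ℕ} [NeZero n] {ω : ℝ} (hω : 0 < ω) {f : EuclideanSpace ℝ (Fin n) → ℝ}
    (hf : MemLp f 2 (sphereUniform (Fin n) ω)) (hf0 : ∫ η, f η ∂(sphereUniform (Fin n) ω) = 0) :
    kacGap n * ∫ η, f η ^ 2 ∂(sphereUniform (Fin n) ω) ≤
      ∫ η, f η * -(kacGenerator n f η) ∂(sphereUniform (Fin n) ω) := by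
  have h1 : kacGap n ≤ spectralGap (sphereUniform (Fin n) ω) (kacGenerator n) := by
    refine ciInf_le (ι := {ω : ℝ // 0 < ω}) ⟨0, ?_⟩ ⟨ω, hω⟩
    rintro _ ⟨ω, rfl⟩
    exact spectralGap_nonneg integral_mul_kacGenerator_nonneg
  exact (mul_le_mul_of_nonneg_right h1 (integral_nonneg fun η => sq_nonneg _)).trans
    (spectralGap_mul_le integral_mul_kacGenerator_nonneg hf hf0)

variable {ι : Type} [Fintype ι] [DecidableEq ι]

lemma planeRotation_piLpCongrLeft {n : ℕ} (e : Fin n ≃ ι) (i j : Fin n) (θ : ℝ)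
    (η : EuclideanSpace ℝ (Fin n)) :
    planeRotation (e i) (e j) θ (LinearIsometryEquiv.piLpCongrLeft 2 ℝ ℝ e η) =
      LinearIsometryEquiv.piLpCongrLeft 2 ℝ ℝ e (planeRotation i j θ η) := by
  ext k
  obtain ⟨k, rfl⟩ := e.surjective k
  simp [planeRotation, LinearIsometryEquiv.piLpCongrLeft_apply, Equiv.piCongrLeft'_apply]

lemma collisionOp_comp_piLpCongrLeft {n : ℕ} (e : Fin n ≃ ι) (i j : Fin n)
    (f : EuclideanSpace ℝ ι → ℝ) (η : EuclideanSpace ℝ (Fin n)) :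
    collisionOp i j (f ∘ LinearIsometryEquiv.piLpCongrLeft 2 ℝ ℝ e) η =
      collisionOp (e i) (e j) f (LinearIsometryEquiv.piLpCongrLeft 2 ℝ ℝ e η) := by
  simp [collisionOp, planeRotation_piLpCongrLeft]

/-- The gap of the Kac walk bounds the mean-field Dirichlet form over any index set. -/
lemma kacGap_mul_norm_sq_le [Nonempty ι] {ω : ℝ} (hω : 0 < ω) {f : EuclideanSpace ℝ ι → ℝ}
    (hf : MemLp f 2 (sphereUniform ι ω)) (hf0 : ∫ η, f η ∂(sphereUniform ι ω) = 0) :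
    kacGap (Fintype.card ι) * ∫ η, f η ^ 2 ∂(sphereUniform ι ω) ≤
      1 / (2 * (Fintype.card ι : ℝ)) *
        ∑ i, ∑ j, ‖(hf.toLp - rotAverage ω i j hf.toLp : SphereL2 ι ω)‖ ^ 2 := by
  have : NeZero (Fintype.card ι) := ⟨Fintype.card_ne_zero⟩
  -- The Kac gap is defined over `Fin n`; relabelling the particles transports measure and
  -- collisions to `ι`.
  set e : Fin (Fintype.card ι) ≃ ι := (Fintype.equivFin ι).symm
  set Φ := LinearIsometryEquiv.piLpCongrLeft 2 ℝ ℝ e with hΦ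
  have hmp := measurePreserving_sphereUniform Φ ω
  have hint : ∀ g : EuclideanSpace ℝ ι → ℝ, ∫ η, g (Φ η) ∂(sphereUniform (Fin _) ω) =
      ∫ η, g η ∂(sphereUniform ι ω) := fun g =>
    hmp.integral_comp Φ.toHomeomorph.measurableEmbedding g
  have h := kacGap_mul_le hω (hf.comp_measurePreserving hmp) ((hint f).trans hf0)
  have e1 : ∫ η, (f ∘ Φ) η ^ 2 ∂(sphereUniform (Fin _) ω) = ∫ η, f η ^ 2 ∂(sphereUniform ι ω) :=
    hint fun η => f η ^ 2
  have e2 : ∫ η, (f ∘ Φ) η * -(kacGenerator (Fintype.card ι) (f ∘ Φ) η)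
      ∂(sphereUniform (Fin _) ω) =
      ∫ η, f η * -(1 / (2 * (Fintype.card ι : ℝ)) * ∑ i, ∑ j, collisionOp i j f η)
        ∂(sphereUniform ι ω) := by
    rw [← hint fun η => f η * -(1 / (2 * (Fintype.card ι : ℝ)) * ∑ i, ∑ j, collisionOp i j f η)]
    congr 1
    funext η
    simp only [kacGenerator, hΦ, collisionOp_comp_piLpCongrLeft, Function.comp_apply]
    rw [← Equiv.sum_comp e fun i => ∑ j, collisionOp i j f _]
    simp only [← Equiv.sum_comp e fun j => collisionOp _ j f _]
  rw [e1, e2] at h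
  exact h.trans_eq (integral_mul_neg_sum hf _ fun _ => Finset.univ)

end Gaps

/-! ### The nearest-neighbour walk. -/

section NearestNeighbour

variable {d N : ℕ}

lemma norm_sub_rotAverage_comparison {ω : ℝ} (f : SphereL2 (Cube d N) ω) :
    ∑ x, ∑ y, ‖f - rotAverage ω x y f‖ ^ 2 ≤ 16 * d * N ^ 2 * N ^ d *
      ∑ x : Cube d N, ∑ y : Cube d N with Cube.dist x y = 1, ‖f - rotAverage ω x y f‖ ^ 2 := by
  have hsymm : ∀ x y, ‖f - rotAverage ω x y f‖ = ‖f - rotAverage ω y x f‖ := fun x y => by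
    rw [rotAverage_comm]
  refine sum_pairs_le_sum_neighbours (a := fun x y => ‖f - rotAverage ω x y f‖)
    (fun _ _ => norm_nonneg _) (fun x => by rw [rotAverage_self, sub_self, norm_zero]) hsymm
    fun x y z => ?_
  have h := norm_sub_rotAverage_triangle z y x f
  rw [hsymm z x, hsymm z y, hsymm y x] at h
  linarith

lemma kacLocGap_ge (hd : 1 ≤ d) (hN : 1 ≤ N) :
    1 / (96 * (d : ℝ) * (N : ℝ) ^ 2) * kacGap (N ^ d) ≤ kacLocGap d N := by
  have : Nonempty (Cube d N) := ⟨fun _ => ⟨0, hN⟩⟩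
  have hd0 : (0 : ℝ) < d := by exact_mod_cast hd
  have hN0 : (0 : ℝ) < N := by exact_mod_cast hN
  refine le_ciInf fun ω => le_spectralGap (exists_admissible ω.2) fun f hf hf0 => ?_
  have h1 := kacGap_mul_norm_sq_le ω.2 hf hf0
  have hcard : Fintype.card (Cube d N) = N ^ d := by simp [Cube]
  rw [hcard, Nat.cast_pow] at h1
  have h2 := norm_sub_rotAverage_comparison (hf.toLp : SphereL2 (Cube d N) ω)
  have h3 : ∫ η, f η * -(kacLocGenerator d N f η) ∂(sphereUniform (Cube d N) ω) =
      1 / 2 * ∑ x : Cube d N, ∑ y : Cube d N with Cube.dist x y = 1,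
        ‖(hf.toLp - rotAverage ω x y hf.toLp : SphereL2 (Cube d N) ω)‖ ^ 2 :=
    integral_mul_neg_sum hf _ fun x => Finset.univ.filter fun y => Cube.dist x y = 1
  rw [h3]
  set S := ∑ x : Cube d N, ∑ y : Cube d N with Cube.dist x y = 1,
    ‖(hf.toLp - rotAverage ω x y hf.toLp : SphereL2 (Cube d N) ω)‖ ^ 2 with hS
  have hS0 : 0 ≤ S := by positivity
  calc 1 / (96 * (d : ℝ) * (N : ℝ) ^ 2) * kacGap (N ^ d) *
        ∫ η, f η ^ 2 ∂(sphereUniform (Cube d N) ω)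
      = 1 / (96 * (d : ℝ) * (N : ℝ) ^ 2) * (kacGap (N ^ d) *
        ∫ η, f η ^ 2 ∂(sphereUniform (Cube d N) ω)) := by ring
    _ ≤ 1 / (96 * (d : ℝ) * (N : ℝ) ^ 2) * (1 / (2 * (N : ℝ) ^ d) *
        (16 * d * N ^ 2 * N ^ d * S)) := by
        refine mul_le_mul_of_nonneg_left (h1.trans ?_) (by positivity)
        exact mul_le_mul_of_nonneg_left h2 (by positivity)
    -- `16 / (2 · 96) = 1/12`. As `1/2` is available, the comparison has room to spare: it would
    -- allow `16` in place of `96`.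
    _ = 1 / 12 * S := by field_simp; ring
    _ ≤ 1 / 2 * S := by linarith

end NearestNeighbour

end

theorem mainTheorem1 (d N : ℕ) (hd : 1 ≤ d) (hN : 1 ≤ N) :
    kacLocGap d N ≥ 1 / (96 * (d : ℝ) * (N : ℝ) ^ 2) * kacGap (N ^ d) ∧
    (2 ≤ N →
      kacGap (N ^ d) ≥ 1 / 4 ∧
      kacLocGap d N ≥ 1 / (384 * (d : ℝ) * (N : ℝ) ^ 2)) := by
  have h1 := kacLocGap_ge hd hN
  refine ⟨h1, fun hN2 => ?_⟩
  -- `N ^ d ≥ N ≥ 2` since `d ≥ 1`, so there are at least two particles.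
  have h2 : 1 / 4 ≤ kacGap (N ^ d) := kacGap_ge (hN2.trans (Nat.le_self_pow (by omega) N))
  refine ⟨h2, le_trans (le_of_eq ?_) ((mul_le_mul_of_nonneg_left h2 (by positivity)).trans h1)⟩
  field_simp
  norm_num
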